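/- Let $\mathbb{K}$ be an algebraically closed field of characteristic zero. All varieties are normal, affine and irreducible over $\mathbb{K}$, and all actions are regular. An $SL(2)$-embedding is a three-dimensional variety $Y$ with a locally transitive (i.e. having an open orbit) and locally free $SL(2)$-action; it has height $h\in\mathbb{Q}$ if for some open equivariant embedding $\varphi: SL(2)\hookrightarrow Y$ one has $\varphi^*(\mathbb{K}[Y]^U)=\langle \alpha^i\beta^j \mid j\le hi\rangle$, where $U$ is the group of lower unitriangular matrices and $\alpha,\beta$ are the entries of the first row of a matrix in $SL(2)$. An $SL(2)/\mathbb{Z}_r$-embedding is a three-dimensional variety $X$ with a locally transitive, not transitive $SL(2)$-action for which the stabilizer of a point of the open orbit is cyclic of order $r$; it has height $h$ if $X\cong Y/\!/\mathbb{Z}_r$ $SL(2)$-equivariantly for some $SL(2)$-embedding $Y$ of height $h$, where $\mathbb{Z}_r\subset SL(2)$ acts on $Y$ by an extension of its action on $SL(2)\subset Y$ by right shifts. Let $p<q$ be coprime positive integers, let $l$ be a positive integer, and let $X$ be an $SL(2)/\mathbb{Z}_{l(q-p)}$-embedding of height $p/q$. Then $X$ is toric, and the cone corresponding to it as a toric variety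 is $$\sigma=\operatorname{cone}\bigl((1,0,0),\,(0,1,0),\,(-1,0,lq),\,(0,-1,lp)\bigr)\subset N_{\mathbb{Q}}\cong\mathbb{Q}^3 .$$ That is, there is a locally transitive action on $X$ of the torus $T=(\mathbb{K}^*)^3$, with character lattice $M=\mathbb{Z}^3$ and dual lattice $N$, such that $\mathbb{K}[X]$ is $T$-equivariantly isomorphic to the semigroup algebra $\mathbb{K}[M\cap\hat\sigma]$, where $\hat\sigma\subset M_{\mathbb{Q}}$ is the dual cone of $\sigma$, and $\sigma$ is a strongly convex polyhedral cone. -/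

import Mathlib

open scoped MatrixGroups

namespace ToricSL2

/-!
An irreducible affine variety `X` over an algebraically closed field `K` is given by its coordinate
ring `A = K[X]`, a finitely generated `K`-algebra without zero divisors. It is normal when `A` is
integrally closed. Its points are the `K`-algebra homomorphisms `A → K`, and the value of `f : A` at
the point `x` is `x f`.
-/

section Varieties

universe u v w

/-- The points of the affine variety with coordinate ring `A`. -/
abbrev Pts (K : Type u) (A : Type v) [Field K] [CommRing A] [Algebra K A] : Type (max v u) :=
  A →ₐ[K] K

/-- Zariski open sets of points: unions of principal open sets. -/
def IsZariskiOpen {K : Type u} {A : Type v} [Field K] [CommRing A] [Algebra K A]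
    (S : Set (Pts K A)) : Prop :=
  ∃ I : Set A, S = {x | ∃ f ∈ I, x f ≠ 0}

/-- A regular (left) action `G × X → X` of an affine algebraic group `G`, with algebra of regular
functions `R = K[G]`, on the affine variety `X` with coordinate ring `A`. Regularity says that the
pullback to `G × X` of a regular function on `X` lies in `K[G] ⊗ A`. -/
structure RegularAction {K : Type u} {G : Type w} [Field K] [Group G]
    (R : Subalgebra K (G → K)) (A : Type v) [CommRing A] [Algebra K A] where
  /-- the action on points -/
  act : G →* Equiv.Perm (Pts K A)
  regular : ∀ f : A, ∃ (n : ℕ) (φ : Fin n → R) (a : Fin n → A),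
    ∀ (g : G) (x : Pts K A), act g x f = ∑ i, (φ i : G → K) g * x (a i)

namespace RegularAction

variable {K : Type u} {G : Type w} [Field K] [Group G] {R : Subalgebra K (G → K)}
  {A : Type v} [CommRing A] [Algebra K A]

/-- The orbit of a point. -/
def orbit (ρ : RegularAction R A) (x : Pts K A) : Set (Pts K A) :=
  Set.range fun g : G => ρ.act g x

/-- The stabilizer of a point. -/
def stabilizer (ρ : RegularAction R A) (x : Pts K A) : Subgroup G :=
  (MulAction.stabilizer (Equiv.Perm (Pts K A)) x).comap ρ.act

/-- The action is locally transitive: there is an open orbit. -/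
def LocallyTransitive (ρ : RegularAction R A) : Prop :=
  ∃ x : Pts K A, IsZariskiOpen (ρ.orbit x)

/-- The action is transitive. -/
def Transitive (ρ : RegularAction R A) : Prop :=
  ∀ x y : Pts K A, ∃ g : G, ρ.act g x = y

/-- The subset `K[X]^H` of functions invariant under a subgroup `H` of `G`. -/
def invariants (ρ : RegularAction R A) (H : Set G) : Set A :=
  {f | ∀ h ∈ H, ∀ x : Pts K A, ρ.act h x f = x f}

end RegularAction

end Varieties

section SL2

universe u v w

/-- The algebra `K[SL(2)]` of regular functions on `SL(2)`, generated by the matrix entries. -/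
def sl2Functions (K : Type u) [Field K] : Subalgebra K (SL(2, K) → K) :=
  Algebra.adjoin K (Set.range fun (ij : Fin 2 × Fin 2) (g : SL(2, K)) => g.1 ij.1 ij.2)

/-- The unipotent subgroup `U` of lower triangular matrices with ones on the diagonal. -/
def lowerUnipotent (K : Type u) [Field K] : Set SL(2, K) :=
  {g | g.1 0 0 = 1 ∧ g.1 0 1 = 0 ∧ g.1 1 1 = 1}

variable {K : Type u} [Field K]

/-- The base point `y` defines an open equivariant embedding `SL(2) → Y`, `g ↦ g • y`: the orbit of
`y` is open and its stabilizer is trivial. (In characteristic zero the orbit map is then an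
isomorphism onto the orbit.) -/
def IsOpenEmbeddingAt {B : Type v} [CommRing B] [Algebra K B]
    (ρ : RegularAction (sl2Functions K) B) (y : Pts K B) : Prop :=
  IsZariskiOpen (ρ.orbit y) ∧ ρ.stabilizer y = ⊥

/-- An affine `SL(2)`-embedding: a three-dimensional variety with a locally transitive and locally
free `SL(2)`-action (normality, affineness and irreducibility are carried by the coordinate ring). -/
def IsSL2Embedding {B : Type v} [CommRing B] [Algebra K B]
    (ρ : RegularAction (sl2Functions K) B) : Prop :=
  ringKrullDim B = 3 ∧ ∃ y : Pts K B, IsOpenEmbeddingAt ρ y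

/-- An affine `SL(2)/ℤ_r`-embedding: a three-dimensional variety with a locally transitive but not
transitive `SL(2)`-action for which the stabilizer of a point of the open orbit is cyclic of
order `r`. -/
def IsSL2ModCyclicEmbedding {A : Type v} [CommRing A] [Algebra K A]
    (ρ : RegularAction (sl2Functions K) A) (r : ℕ) : Prop :=
  ringKrullDim A = 3 ∧ ¬ ρ.Transitive ∧
    ∃ x : Pts K A, IsZariskiOpen (ρ.orbit x) ∧
      IsCyclic (ρ.stabilizer x) ∧ Nat.card (ρ.stabilizer x) = r

/-- The `SL(2)`-embedding `Y` has height `h`: for some open equivariant embedding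
`φ : SL(2) → Y`, `g ↦ g • y`, the image `φ^*(K[Y]^U)` is spanned by the monomials `α ^ i * β ^ j`
with `j / i ≤ h` (where `i = j = 0` is allowed), `α` and `β` being the entries of the first row. -/
def EmbeddingHasHeight {B : Type v} [CommRing B] [Algebra K B]
    (ρ : RegularAction (sl2Functions K) B) (h : ℚ) : Prop :=
  ∃ y : Pts K B, IsOpenEmbeddingAt ρ y ∧
    (fun (f : B) (g : SL(2, K)) => ρ.act g y f) '' ρ.invariants (lowerUnipotent K) =
      (Submodule.span K {m : SL(2, K) → K | ∃ i j : ℕ, (j : ℚ) ≤ h * i ∧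
        m = fun g => g.1 0 0 ^ i * g.1 0 1 ^ j} : Set (SL(2, K) → K))

/-- `X ≅ Y // C` as `SL(2)`-varieties, where the finite subgroup `C` of `SL(2)` acts on the
`SL(2)`-embedding `Y` by an extension of its action on `SL(2) ⊆ Y` by right shifts. Here `θ c` is the
comorphism of the automorphism of `Y` that extends `g ↦ g * c`, and `π` is the comorphism of the
quotient morphism `Y → X`. -/
def IsRightQuotient {A : Type v} [CommRing A] [Algebra K A] {B : Type w} [CommRing B] [Algebra K B]
    (ρX : RegularAction (sl2Functions K) A) (ρY : RegularAction (sl2Functions K) B)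
    (C : Subgroup SL(2, K)) : Prop :=
  ∃ y : Pts K B, IsOpenEmbeddingAt ρY y ∧
    ∃ θ : C → (B →ₐ[K] B),
      (∀ (c : C) (g : SL(2, K)) (f : B), ρY.act g y (θ c f) = ρY.act (g * c) y f) ∧
      ∃ π : A →ₐ[K] B, Function.Injective π ∧
        Set.range π = {f | ∀ c : C, θ c f = f} ∧
        ∀ (g : SL(2, K)) (z : Pts K B), (ρY.act g z).comp π = ρX.act g (z.comp π)

/-- The `SL(2)/ℤ_r`-embedding `X` has height `h`: there is a normal affine `SL(2)`-embedding `Y` of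
height `h` with `X ≅ Y // ℤ_r`, where `ℤ_r ⊆ SL(2)` acts on `Y` by right shifts. -/
def HasHeight {A : Type v} [CommRing A] [Algebra K A]
    (ρ : RegularAction (sl2Functions K) A) (r : ℕ) (h : ℚ) : Prop :=
  ∃ (B : Type u) (_ : CommRing B) (_ : IsDomain B) (_ : IsIntegrallyClosed B) (_ : Algebra K B)
    (_ : Algebra.FiniteType K B) (ρY : RegularAction (sl2Functions K) B) (C : Subgroup SL(2, K)),
    IsSL2Embedding ρY ∧ EmbeddingHasHeight ρY h ∧
      IsCyclic C ∧ Nat.card C = r ∧ IsRightQuotient ρ ρY C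

end SL2

section Toric

universe u v

/-- The algebra of regular functions on the torus `T = (Kˣ)^n`: Laurent polynomials in the
coordinates. -/
def torusFunctions (K : Type u) [Field K] (n : ℕ) : Subalgebra K ((Fin n → Kˣ) → K) :=
  Algebra.adjoin K
    ((Set.range fun (i : Fin n) (t : Fin n → Kˣ) => (t i : K)) ∪
      Set.range fun (i : Fin n) (t : Fin n → Kˣ) => ((t i)⁻¹ : K))

/-- The character `χ^m : T → Kˣ` for `m` in the character lattice `M = ℤ^n`. -/
def character {K : Type u} [Field K] {n : ℕ} (m : Fin n → ℤ) (t : Fin n → Kˣ) : Kˣ :=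
  ∏ i, t i ^ m i

/-- The semigroup `M ∩ σ^∨` of lattice points in the dual of a cone `σ` in `N_ℚ = ℚ^n`. -/
def dualMonoid {n : ℕ} (σ : PointedCone ℚ (Fin n → ℚ)) : AddSubmonoid (Fin n → ℤ) where
  carrier := {m | ∀ w ∈ σ, 0 ≤ ∑ i, (m i : ℚ) * w i}
  zero_mem' := by
    intro w _
    simp
  add_mem' := by
    intro a b ha hb w hw
    have h := add_nonneg (ha w hw) (hb w hw)
    simpa [add_mul, Finset.sum_add_distrib] using h

/-- `X`, with the action `ρ` of the torus `T = (Kˣ)^n`, is a toric variety that corresponds to the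
cone `σ`: the action is locally transitive, `σ` is a strongly convex (rational) polyhedral cone in
`N_ℚ`, and `K[X]` is `T`-equivariantly isomorphic to the semigroup algebra `K[M ∩ σ^∨]`, in which the
basis element of `m` is the restriction of the character `χ^m`. -/
def IsToricWithCone {K : Type u} [Field K] {A : Type v} [CommRing A] [Algebra K A] {n : ℕ}
    (ρ : RegularAction (torusFunctions K n) A) (σ : PointedCone ℚ (Fin n → ℚ)) : Prop :=
  ρ.LocallyTransitive ∧ σ.FG ∧ (∀ w ∈ σ, -w ∈ σ → w = 0) ∧
    ∃ e : AddMonoidAlgebra K (dualMonoid σ) ≃ₐ[K] A,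
      ∀ (m : dualMonoid σ) (t : Fin n → Kˣ) (x : Pts K A),
        ρ.act t x (e (AddMonoidAlgebra.single m 1)) =
          (character m.1 t : K) * x (e (AddMonoidAlgebra.single m 1))

end Toric

end ToricSL2

open ToricSL2

/-! Write α, β and γ, δ for the rows of a matrix in SL(2). The orbit map at a point of the open
orbit embeds K[Y] in K[SL(2)] as a subspace stable under left translations. Such a subspace is
recovered from its functions of α, β alone (`eq_bidegreeSpan`), so height p/q means that K[Y] is
spanned by the monomials α^a γ^a' β^b δ^b' with q(b + b') ≤ p(a + a').

Right shifts by a suitable conjugate of the cyclic group preserve this image. It contains α but not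
β, so the conjugate group is upper triangular. Having finite order, it becomes diagonal after the
base point is moved by an upper unitriangular matrix, and this move keeps the spanning monomials
(`exists_orbitMap_quotient`).

A generator diag(ζ, ζ⁻¹) scales a monomial of bidegree (i, j) = (a + a', b + b') by ζ^(i - j). Hence
K[X] is spanned by the monomials with i - j = l(q - p)z, for which the height condition reads j ≤
lpz. As αδ - βγ = 1, multiplication by a power of the determinant raises the bidegree to (lqz, lpz)
(`mem_range_coneHom_iff`). Monomials of these bidegrees are indexed by (a, b, z) with 0 ≤ a ≤ lqz
and 0 ≤ b ≤ lpz, the lattice points of the dual cone. They are linearly independent because α/γ, β/δ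
and γ^(lq) δ^(lp) can be prescribed on a nonempty open set (`coneHom_injective`). Thus K[X] is the
semigroup algebra, and the torus acts through its grading. -/

namespace ToricSL2

universe u v w

/-! ### Nullstellensatz and density of open sets -/

section Density

variable {K : Type u} [Field K] [IsAlgClosed K] {B : Type v} [CommRing B] [IsDomain B] [Algebra K B]
  [Algebra.FiniteType K B]

/-- Nullstellensatz: `B` is a Jacobson domain, so its maximal ideals meet in zero, and each residue
field is finite over `K`, hence equal to `K`. -/
theorem eq_zero_of_forall_pts {f : B} (hf : ∀ x : Pts K B, x f = 0) : f = 0 := by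
  have hJ : IsJacobsonRing B := isJacobsonRing_of_finiteType (A := K)
  have hrad : (⊥ : Ideal B).jacobson = ⊥ :=
    hJ.out (Ideal.isPrime_bot.isRadical)
  rw [← Ideal.mem_bot, ← hrad, Ideal.jacobson, Ideal.mem_sInf]
  rintro m ⟨-, hm⟩
  let _ := Ideal.Quotient.field m
  have hfin : Module.Finite K (B ⧸ m) := finite_of_finite_type_of_isJacobsonRing K (B ⧸ m)
  have hbij : Function.Bijective (algebraMap K (B ⧸ m)) :=
    IsAlgClosed.algebraMap_bijective_of_isIntegral
  let e : K ≃ₐ[K] (B ⧸ m) := AlgEquiv.ofBijective (Algebra.ofId K (B ⧸ m)) hbij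
  have h := hf ((e.symm : (B ⧸ m) →ₐ[K] K).comp (Ideal.Quotient.mkₐ K m))
  have h2 : e.symm (Ideal.Quotient.mk m f) = 0 := h
  rw [EmbeddingLike.map_eq_zero_iff] at h2
  exact Ideal.Quotient.eq_zero_iff_mem.mp h2

theorem IsZariskiOpen.eq_zero {S : Set (Pts K B)} (hS : IsZariskiOpen S) (hne : S.Nonempty) {f : B}
    (hf : ∀ x ∈ S, x f = 0) : f = 0 := by
  obtain ⟨I, rfl⟩ := hS
  obtain ⟨x, h, hI, hx⟩ := hne
  have hh : h ≠ 0 := by rintro rfl; exact hx (map_zero x)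
  have : f * h = 0 := eq_zero_of_forall_pts (K := K) fun z => by
    by_cases hz : z h = 0
    · simp [hz]
    · simp [hf z ⟨h, hI, hz⟩]
  exact (mul_eq_zero.mp this).resolve_right hh

theorem IsZariskiOpen.inter_nonempty {S T : Set (Pts K B)} (hS : IsZariskiOpen S)
    (hT : IsZariskiOpen T) (hSne : S.Nonempty) (hTne : T.Nonempty) : (S ∩ T).Nonempty := by
  by_contra hcon
  obtain ⟨I, rfl⟩ := hS
  obtain ⟨x, h, hI, hx⟩ := hSne
  have hh : h ≠ 0 := by rintro rfl; exact hx (map_zero x)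
  refine hh (hT.eq_zero hTne fun z hz => ?_)
  by_contra hzh
  exact hcon ⟨z, ⟨h, hI, hzh⟩, hz⟩

end Density

/-! ### Orbit maps -/

namespace RegularAction

variable {K : Type u} {G : Type w} [Field K] [Group G] {R : Subalgebra K (G → K)}
  {A : Type v} [CommRing A] [Algebra K A]

theorem act_mul (ρ : RegularAction R A) (g h : G) (x : Pts K A) :
    ρ.act (g * h) x = ρ.act g (ρ.act h x) := by simp

/-- The comorphism of the orbit map `g ↦ g • y`, as a map to functions on the group. -/
def orbitMap (ρ : RegularAction R A) (y : Pts K A) : A →ₐ[K] (G → K) :=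
  AlgHom.pi fun g => ρ.act g y

@[simp]
theorem orbitMap_apply (ρ : RegularAction R A) (y : Pts K A) (f : A) (g : G) :
    ρ.orbitMap y f g = ρ.act g y f := rfl

theorem orbit_nonempty (ρ : RegularAction R A) (y : Pts K A) : (ρ.orbit y).Nonempty :=
  ⟨_, 1, rfl⟩

theorem orbitMap_mem (ρ : RegularAction R A) (y : Pts K A) (f : A) : ρ.orbitMap y f ∈ R := by
  obtain ⟨n, φ, a, h⟩ := ρ.regular f
  have : ρ.orbitMap y f = ∑ i, y (a i) • (φ i : G → K) := by
    ext g
    simp [h, mul_comm]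
  rw [this]
  exact sum_mem fun i _ => R.smul_mem (φ i).2 _

theorem exists_translate (ρ : RegularAction R A) (g : G) (f : A) :
    ∃ b : A, ∀ x : Pts K A, x b = ρ.act g x f := by
  obtain ⟨n, φ, a, h⟩ := ρ.regular f
  exact ⟨∑ i, (φ i : G → K) g • a i, fun x => by simp [h]⟩

theorem orbitMap_injective [IsAlgClosed K] [IsDomain A] [Algebra.FiniteType K A]
    (ρ : RegularAction R A) {y : Pts K A} (hy : IsZariskiOpen (ρ.orbit y)) :
    Function.Injective (ρ.orbitMap y) := by
  rw [injective_iff_map_eq_zero]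
  intro f hf
  refine hy.eq_zero (ρ.orbit_nonempty y) ?_
  rintro _ ⟨g, rfl⟩
  exact congrFun hf g

theorem translate_mem_range_orbitMap (ρ : RegularAction R A) (y : Pts K A) {F : G → K}
    (hF : F ∈ (ρ.orbitMap y).range) (g : G) : (fun x => F (g * x)) ∈ (ρ.orbitMap y).range := by
  obtain ⟨f, rfl⟩ := hF
  obtain ⟨b, hb⟩ := ρ.exists_translate g f
  exact ⟨b, by ext x; simp [hb]⟩

theorem orbitMap_act (ρ : RegularAction R A) (y : Pts K A) (g₀ : G) (f : A) (g : G) :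
    ρ.orbitMap (ρ.act g₀ y) f g = ρ.orbitMap y f (g * g₀) := by simp

theorem orbit_act (ρ : RegularAction R A) (y : Pts K A) (g₀ : G) :
    ρ.orbit (ρ.act g₀ y) = ρ.orbit y := by
  ext z
  constructor
  · rintro ⟨g, rfl⟩
    exact ⟨g * g₀, by simp⟩
  · rintro ⟨g, rfl⟩
    exact ⟨g * g₀⁻¹, by simp⟩

/-- Irreducibility makes two open orbits meet, hence coincide. This compares the base points chosen
in different definitions. -/
theorem exists_act_eq [IsAlgClosed K] [IsDomain A] [Algebra.FiniteType K A]
    (ρ : RegularAction R A) {x y : Pts K A} (hx : IsZariskiOpen (ρ.orbit x))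
    (hy : IsZariskiOpen (ρ.orbit y)) : ∃ g : G, y = ρ.act g x := by
  obtain ⟨_, ⟨g, rfl⟩, ⟨h, hh⟩⟩ :=
    hx.inter_nonempty hy (ρ.orbit_nonempty x) (ρ.orbit_nonempty y)
  refine ⟨h⁻¹ * g, ?_⟩
  have : ρ.act h y = ρ.act g x := hh
  rw [act_mul, ← this, ← act_mul]
  simp

theorem mem_invariants_of_orbitMap [IsAlgClosed K] [IsDomain A] [Algebra.FiniteType K A]
    (ρ : RegularAction R A) {y : Pts K A} (hy : IsZariskiOpen (ρ.orbit y)) {H : Set G} {f : A}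
    (hf : ∀ h ∈ H, ∀ g, ρ.orbitMap y f (h * g) = ρ.orbitMap y f g) : f ∈ ρ.invariants H := by
  intro h hh x
  obtain ⟨b, hb⟩ := ρ.exists_translate h f
  have : b = f := ρ.orbitMap_injective hy (by
    ext g
    have := hf h hh g
    simpa [hb] using this)
  rw [← hb, this]

end RegularAction

/-! ### Coefficients of polynomial curves in a subspace -/

section Interpolation

variable {K : Type u} [Field K] [Infinite K] {M : Type v} [AddCommGroup M] [Module K M]

/-- The coefficients of a polynomial curve that stays in a subspace lie in the subspace. -/
theorem sum_filter_mem_of_forall_sum_pow_smul_mem {ι : Type*} (S : Submodule K M) (I : Finset ι)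
    (d : ι → ℕ) (c : ι → M) (h : ∀ s : K, ∑ t ∈ I, s ^ d t • c t ∈ S) (k : ℕ) :
    ∑ t ∈ I with d t = k, c t ∈ S := by
  -- A linear functional that vanishes on `S` but not on the coefficient turns the curve into a
  -- scalar polynomial with every element of the infinite field as a root.
  by_contra hk
  obtain ⟨f, hf, hS⟩ := Submodule.exists_le_ker_of_notMem hk
  refine hf ?_
  have h0 : ∑ t ∈ I, Polynomial.monomial (d t) (f (c t)) = 0 := by
    refine Polynomial.funext fun s => ?_
    have := hS (h s)
    simpa [Polynomial.eval_finsetSum, mul_comm] using this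
  have := congrArg (fun P => Polynomial.coeff P k) h0
  simpa [Polynomial.finsetSum_coeff, apply_ite f, Polynomial.coeff_monomial, Finset.sum_filter] using this

end Interpolation

/-! ### Monomials on SL(2) and the determinant relation -/

section Monomials

variable {K : Type u} [Field K]

/-- The function `α ^ a * γ ^ a' * β ^ b * δ ^ b'` on `SL(2)`, where `α, β` and `γ, δ` are the rows
of a matrix. -/
def mono (a a' b b' : ℕ) : SL(2, K) → K := fun g =>
  g.1 0 0 ^ a * g.1 1 0 ^ a' * g.1 0 1 ^ b * g.1 1 1 ^ b'

theorem mono_apply (a a' b b' : ℕ) (g : SL(2, K)) :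
    mono a a' b b' g = g.1 0 0 ^ a * g.1 1 0 ^ a' * g.1 0 1 ^ b * g.1 1 1 ^ b' := rfl

theorem mono_mul_mono (a a' b b' c c' d d' : ℕ) :
    (mono a a' b b' * mono c c' d d' : SL(2, K) → K) = mono (a + c) (a' + c') (b + d) (b' + d') := by
  ext g
  simp only [Pi.mul_apply, mono_apply]
  ring

theorem sl2_det (g : SL(2, K)) : g.1 0 0 * g.1 1 1 - g.1 0 1 * g.1 1 0 = 1 := by
  rw [← Matrix.det_fin_two]
  exact g.2

theorem mono_det (a a' b b' : ℕ) :
    (mono (a + 1) a' b (b' + 1) - mono a (a' + 1) (b + 1) b' : SL(2, K) → K) = mono a a' b b' := by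
  ext g
  simp only [Pi.sub_apply, mono_apply]
  linear_combination (g.1 0 0 ^ a * g.1 1 0 ^ a' * g.1 0 1 ^ b * g.1 1 1 ^ b') * sl2_det g

theorem sl2Functions_le_span_mono :
    (sl2Functions K).toSubmodule ≤
      Submodule.span K {F | ∃ a a' b b', F = (mono a a' b b' : SL(2, K) → K)} := by
  intro F hF
  change F ∈ Algebra.adjoin K _ at hF
  induction hF using Algebra.adjoin_induction with
  | mem F h =>
    obtain ⟨⟨i, j⟩, rfl⟩ := h
    apply Submodule.subset_span
    fin_cases i <;> fin_cases j
    · exact ⟨1, 0, 0, 0, by ext g; simp [mono_apply]⟩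
    · exact ⟨0, 0, 1, 0, by ext g; simp [mono_apply]⟩
    · exact ⟨0, 1, 0, 0, by ext g; simp [mono_apply]⟩
    · exact ⟨0, 0, 0, 1, by ext g; simp [mono_apply]⟩
  | algebraMap r =>
    rw [Algebra.algebraMap_eq_smul_one]
    exact Submodule.smul_mem _ _ (Submodule.subset_span
      ⟨0, 0, 0, 0, by ext g; simp [mono_apply]⟩)
  | add F G _ _ h₁ h₂ => exact add_mem h₁ h₂
  | mul F G _ _ h₁ h₂ =>
    have h := Submodule.mul_mem_mul h₁ h₂
    rw [Submodule.span_mul_span] at h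
    refine Submodule.span_mono ?_ h
    rintro _ ⟨_, ⟨a, a', b, b', rfl⟩, _, ⟨c, c', d, d', rfl⟩, rfl⟩
    exact ⟨_, _, _, _, mono_mul_mono ..⟩

/-- The span of the monomials obtained by dividing out a determinant from monomials of bidegree
`(u, v)` and of degree `k` in the second row. -/
def detSpan (K : Type u) [Field K] (u v k : ℕ) : Submodule K (SL(2, K) → K) :=
  Submodule.span K {F | ∃ a a' b b', a + a' + 1 = u ∧ b + b' + 1 = v ∧ a' + b' + 1 = k ∧
    F = mono a a' b b'}

theorem mono_shift_sub_mem (x x' y y' n : ℕ) :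
    (mono (x + n) x' y (y' + n) - mono x (x' + n) (y + n) y' : SL(2, K) → K) ∈
      detSpan K (x + x' + n) (y + y' + n) (x' + y' + n) := by
  induction n generalizing x' y with
  | zero => simp
  | succ n ih =>
    have h₁ := ih (x' + 1) (y + 1)
    rw [← sub_add_sub_cancel _ (mono (x + n) (x' + 1) (y + 1) (y' + n))]
    refine add_mem ?_ ?_
    · rw [← add_assoc x, ← add_assoc y', mono_det]
      exact Submodule.subset_span ⟨_, _, _, _, by ring, by ring, by ring, rfl⟩
    · convert h₁ using 2 <;> ring_nf

/-- Equal bidegree and equal second-row degree mean that the two monomials differ by exchanging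
powers of αδ and γβ; each single exchange costs one determinant. -/
theorem mono_sub_mono_mem {a a' b b' c c' d d' : ℕ} (h₁ : a + a' = c + c') (h₂ : b + b' = d + d')
    (h₃ : a' + b' = c' + d') :
    (mono a a' b b' - mono c c' d d' : SL(2, K) → K) ∈ detSpan K (a + a') (b + b') (a' + b') := by
  rcases le_total c a with h | h
  · obtain ⟨n, rfl⟩ := Nat.exists_eq_add_of_le h
    obtain rfl : c' = a' + n := by omega
    obtain rfl : b' = d' + n := by omega
    obtain rfl : d = b + n := by omega
    convert mono_shift_sub_mem (K := K) c a' b d' n using 2 <;> ring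
  · obtain ⟨n, rfl⟩ := Nat.exists_eq_add_of_le h
    obtain rfl : a' = c' + n := by omega
    obtain rfl : d' = b' + n := by omega
    obtain rfl : b = d + n := by omega
    rw [← neg_mem_iff, neg_sub]
    convert mono_shift_sub_mem (K := K) a c' d b' n using 2 <;> ring

end Monomials

/-! ### Monomials generated by left translations, and top coefficients -/

section Generation

variable {K : Type u} [Field K]

/-- The upper unitriangular matrix with entry `s`. -/
def upperElem (s : K) : SL(2, K) := ⟨!![1, s; 0, 1], by simp⟩

/-- The lower unitriangular matrix with entry `s`. -/
def lowerElem (s : K) : SL(2, K) := ⟨!![1, 0; s, 1], by simp⟩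

theorem sl2_mul_apply (g h : SL(2, K)) (i j : Fin 2) :
    (g * h).1 i j = g.1 i 0 * h.1 0 j + g.1 i 1 * h.1 1 j := by
  rw [← Fin.sum_univ_two (fun k => g.1 i k * h.1 k j)]
  exact Matrix.mul_apply

section entries

variable (s : K)

@[simp] theorem upperElem_zero_zero : (upperElem s).1 0 0 = 1 := rfl
@[simp] theorem upperElem_zero_one : (upperElem s).1 0 1 = s := rfl
@[simp] theorem upperElem_one_zero : (upperElem s).1 1 0 = 0 := rfl
@[simp] theorem upperElem_one_one : (upperElem s).1 1 1 = 1 := rfl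
@[simp] theorem lowerElem_zero_zero : (lowerElem s).1 0 0 = 1 := rfl
@[simp] theorem lowerElem_zero_one : (lowerElem s).1 0 1 = 0 := rfl
@[simp] theorem lowerElem_one_zero : (lowerElem s).1 1 0 = s := rfl
@[simp] theorem lowerElem_one_one : (lowerElem s).1 1 1 = 1 := rfl

end entries

theorem upper_translate_mono (u v : ℕ) (s : K) :
    (fun x => mono u 0 v 0 (upperElem s * x)) =
      ∑ t ∈ Finset.range (u + 1) ×ˢ Finset.range (v + 1), s ^ (t.1 + t.2) •
        (((u.choose t.1 * v.choose t.2 : ℕ) : K) •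
          (mono (u - t.1) t.1 (v - t.2) t.2 : SL(2, K) → K)) := by
  ext x
  rw [Finset.sum_product, Finset.sum_apply]
  simp only [mono_apply, sl2_mul_apply, upperElem_zero_zero, upperElem_zero_one, one_mul,
    pow_zero, mul_one, Finset.sum_apply, Pi.smul_apply, smul_eq_mul]
  rw [add_comm (x.1 0 0), add_comm (x.1 0 1), add_pow, add_pow, Finset.sum_mul_sum]
  refine Finset.sum_congr rfl fun m _ => Finset.sum_congr rfl fun n _ => ?_
  push_cast
  ring

/-- Translating α^u β^v by upper unitriangular matrices and taking the coefficient of degree a' + b'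
gives a positive combination of monomials of bidegree (u, v). These agree modulo bidegree (u - 1, v
- 1), which induction on u handles, so a nonzero multiple of the wanted monomial remains. -/
theorem mono_mem_of_bidegree [CharZero K] (S : Submodule K (SL(2, K) → K))
    (hS : ∀ g, ∀ F ∈ S, (fun x => F (g * x)) ∈ S) (E : Set (ℕ × ℕ))
    (hE : ∀ i j, (i + 1, j + 1) ∈ E → (i, j) ∈ E)
    (hES : ∀ i j, (i, j) ∈ E → mono i 0 j 0 ∈ S) (a a' b b' : ℕ) (h : (a + a', b + b') ∈ E) :
    mono a a' b b' ∈ S := by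
  obtain ⟨u, hu⟩ : ∃ u, a + a' = u := ⟨_, rfl⟩
  obtain ⟨v, hv⟩ : ∃ v, b + b' = v := ⟨_, rfl⟩
  induction u using Nat.strong_induction_on generalizing a a' b b' v with
  | _ u ih =>
    rw [hu, hv] at h
    have hdet : ∀ k, detSpan K u v k ≤ S := by
      intro k
      refine Submodule.span_le.mpr ?_
      rintro _ ⟨c, c', d, d', h₁, h₂, -, rfl⟩
      refine ih (c + c') (by omega) c c' d d' ?_ rfl _ rfl
      apply hE
      rwa [h₁, h₂]
    have hsum := sum_filter_mem_of_forall_sum_pow_smul_mem S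
      (Finset.range (u + 1) ×ˢ Finset.range (v + 1)) (fun t => t.1 + t.2)
      (fun t => ((u.choose t.1 * v.choose t.2 : ℕ) : K) •
          (mono (u - t.1) t.1 (v - t.2) t.2 : SL(2, K) → K))
      (fun s => by rw [← upper_translate_mono]; exact hS _ _ (hES _ _ h)) (a' + b')
    set I := (Finset.range (u + 1) ×ˢ Finset.range (v + 1)).filter (fun t => t.1 + t.2 = a' + b')
      with hI
    have hdiff : ∑ t ∈ I, ((u.choose t.1 * v.choose t.2 : ℕ) : K) •
        (mono (u - t.1) t.1 (v - t.2) t.2 - mono a a' b b' : SL(2, K) → K) ∈ S := by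
      refine sum_mem fun t ht => S.smul_mem _ ?_
      simp only [hI, Finset.mem_filter, Finset.mem_product, Finset.mem_range] at ht
      have := mono_sub_mono_mem (K := K) (a := u - t.1) (a' := t.1) (b := v - t.2) (b' := t.2)
        (c := a) (c' := a') (d := b) (d' := b') (by omega) (by omega) (by omega)
      rw [Nat.sub_add_cancel (by omega), Nat.sub_add_cancel (by omega)] at this
      exact hdet _ this
    have hmul := sub_mem hsum hdiff
    rw [← Finset.sum_sub_distrib] at hmul
    simp only [← smul_sub, sub_sub_cancel] at hmul
    rw [← Finset.sum_smul, ← Nat.cast_sum] at hmul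
    -- The total coefficient is a positive integer, since the index (a', b') occurs, so it is
    -- invertible in characteristic zero.
    refine (S.smul_mem_iff (Nat.cast_ne_zero.mpr (Nat.pos_iff_ne_zero.mp ?_))).mp hmul
    refine Finset.sum_pos (fun t ht => ?_) ⟨(a', b'), ?_⟩
    · simp only [hI, Finset.mem_filter, Finset.mem_product, Finset.mem_range] at ht
      exact Nat.mul_pos (Nat.choose_pos (by omega)) (Nat.choose_pos (by omega))
    · exact Finset.mem_filter.mpr ⟨Finset.mem_product.mpr ⟨Finset.mem_range.mpr (by omega),
        Finset.mem_range.mpr (by omega)⟩, rfl⟩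

/-- `F (u * g)`, for the lower unitriangular matrix `u` with entry `s`, is a polynomial in `s` of
degree at most `n`, with `n`-th coefficient `H`. -/
def HasLowerTop (n : ℕ) (F H : SL(2, K) → K) : Prop :=
  ∃ P : Polynomial (SL(2, K) → K), P.natDegree ≤ n ∧ P.coeff n = H ∧
    ∀ s, (fun x => F (lowerElem s * x)) = P.eval (algebraMap K _ s)

theorem HasLowerTop.add {n : ℕ} {F F' H H' : SL(2, K) → K} (h : HasLowerTop n F H)
    (h' : HasLowerTop n F' H') : HasLowerTop n (F + F') (H + H') := by
  obtain ⟨P, h₁, h₂, h₃⟩ := h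
  obtain ⟨P', h₁', h₂', h₃'⟩ := h'
  refine ⟨P + P', Polynomial.natDegree_add_le_of_degree_le h₁ h₁', by simp [h₂, h₂'], fun s => ?_⟩
  rw [Polynomial.eval_add, ← h₃, ← h₃']
  rfl

theorem HasLowerTop.smul {n : ℕ} {F H : SL(2, K) → K} (h : HasLowerTop n F H) (c : K) :
    HasLowerTop n (c • F) (c • H) := by
  obtain ⟨P, h₁, h₂, h₃⟩ := h
  refine ⟨c • P, (Polynomial.natDegree_smul_le _ _).trans h₁, by simp [h₂], fun s => ?_⟩
  rw [Polynomial.eval_smul, ← h₃]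
  rfl

theorem HasLowerTop.of_lt {m n : ℕ} {F H : SL(2, K) → K} (h : HasLowerTop m F H) (hmn : m < n) :
    HasLowerTop n F 0 := by
  obtain ⟨P, h₁, h₂, h₃⟩ := h
  exact ⟨P, h₁.trans hmn.le, Polynomial.coeff_eq_zero_of_natDegree_lt (h₁.trans_lt hmn), h₃⟩

theorem HasLowerTop.zero (n : ℕ) : HasLowerTop n (0 : SL(2, K) → K) 0 :=
  ⟨0, by simp, by simp, fun s => by ext; simp⟩

theorem HasLowerTop.sum {n : ℕ} {ι : Type*} {s : Finset ι} {F H : ι → SL(2, K) → K}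
    (h : ∀ i ∈ s, HasLowerTop n (F i) (H i)) : HasLowerTop n (∑ i ∈ s, F i) (∑ i ∈ s, H i) := by
  classical
  induction s using Finset.induction_on with
  | empty => exact .zero n
  | insert i s hi ih =>
    rw [Finset.sum_insert hi, Finset.sum_insert hi]
    exact (h i (Finset.mem_insert_self i s)).add
      (ih fun j hj => h j (Finset.mem_insert_of_mem hj))

theorem HasLowerTop.mem [Infinite K] {n : ℕ} {F H : SL(2, K) → K} (h : HasLowerTop n F H)
    {S : Submodule K (SL(2, K) → K)} (hS : ∀ g, ∀ F ∈ S, (fun x => F (g * x)) ∈ S) (hF : F ∈ S) :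
    H ∈ S := by
  obtain ⟨P, h₁, h₂, h₃⟩ := h
  have := sum_filter_mem_of_forall_sum_pow_smul_mem S (Finset.range (n + 1)) (fun t => t)
    (fun t => P.coeff t) (fun s => by
      have h := hS (lowerElem s) F hF
      rw [h₃, Polynomial.eval_eq_sum_range' (Nat.lt_succ_of_le h₁)] at h
      convert h using 2 with t ht
      rw [← map_pow, Algebra.smul_def, mul_comm]) n
  rw [Finset.sum_filter, Finset.sum_ite_eq' ] at this
  simpa [h₂] using this

/-- Translation replaces γ by γ + sα and δ by δ + sβ, so in the top coefficient the second row
becomes the first. -/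
theorem hasLowerTop_mono (a a' b b' : ℕ) :
    HasLowerTop (a' + b') (mono a a' b b' : SL(2, K) → K) (mono (a + a') 0 (b + b') 0) := by
  have hlin : ∀ f g : SL(2, K) → K, (Polynomial.C f * Polynomial.X + Polynomial.C g).natDegree ≤ 1 :=
    fun f g => Polynomial.natDegree_linear_le
  have hpow : ∀ (f g : SL(2, K) → K) (m : ℕ),
      ((Polynomial.C f * Polynomial.X + Polynomial.C g) ^ m).natDegree ≤ m := fun f g m => by
    simpa using Polynomial.natDegree_pow_le_of_le m (hlin f g)
  refine ⟨Polynomial.C (mono a 0 b 0) *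
    ((Polynomial.C (mono 1 0 0 0) * Polynomial.X + Polynomial.C (mono 0 1 0 0)) ^ a' *
      (Polynomial.C (mono 0 0 1 0) * Polynomial.X + Polynomial.C (mono 0 0 0 1)) ^ b'), ?_, ?_, ?_⟩
  · exact (Polynomial.natDegree_C_mul_le _ _).trans
      (Polynomial.natDegree_mul_le_of_le (hpow _ _ _) (hpow _ _ _))
  · rw [Polynomial.coeff_C_mul, Polynomial.coeff_mul_add_eq_of_natDegree_le (hpow _ _ _) (hpow _ _ _)]
    have hc : ∀ (f g : SL(2, K) → K) (m : ℕ),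
        ((Polynomial.C f * Polynomial.X + Polynomial.C g) ^ m).coeff m = f ^ m := fun f g m => by
      have := Polynomial.coeff_pow_of_natDegree_le (m := m) (hlin f g)
      simpa using this
    rw [hc, hc]
    ext x
    simp [mono_apply]
    ring
  · intro s
    ext x
    simp [mono_apply, sl2_mul_apply]
    ring

end Generation

/-! ### Linear independence of the first-row monomials -/

section Independence

variable {K : Type u} [Field K] [Infinite K]

/-- Multiplying by `q` extends the vanishing to all points, which makes the product the zero
polynomial; `q` then cancels. -/
theorem finsupp_eq_zero_of_forall_eval {σ ι : Type*} [Fintype σ] {q : MvPolynomial σ K} (hq : q ≠ 0)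
    {e : ι → σ →₀ ℕ} (he : Function.Injective e) {c : ι →₀ K}
    (h : ∀ t : σ → K, MvPolynomial.eval t q ≠ 0 → (c.sum fun m r => r * ∏ i, t i ^ e m i) = 0) :
    c = 0 := by
  have hp : (c.sum fun m r => MvPolynomial.monomial (e m) r) * q = 0 := by
    refine MvPolynomial.funext fun t => ?_
    by_cases ht : MvPolynomial.eval t q = 0
    · simp [ht]
    · rw [map_mul, Finsupp.sum, map_sum]
      have := h t ht
      simp only [Finsupp.sum] at this
      simp [MvPolynomial.eval_monomial, Finsupp.prod_fintype, this]
  have hp := (mul_eq_zero.mp hp).resolve_right hq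
  ext m
  classical
  have := congrArg (MvPolynomial.coeff (e m)) hp
  rw [Finsupp.sum, MvPolynomial.coeff_sum] at this
  simp only [MvPolynomial.coeff_monomial, he.eq_iff] at this
  simpa using this

/-- The monomials in the first row of a matrix. -/
def rowMono (K : Type u) [Field K] (ij : ℕ × ℕ) : SL(2, K) → K := mono ij.1 0 ij.2 0

theorem linearIndependent_rowMono : LinearIndependent K (rowMono K) := by
  rw [linearIndependent_iff]
  intro c hc
  refine finsupp_eq_zero_of_forall_eval (σ := Fin 2) (q := MvPolynomial.X 0)
    (MvPolynomial.X_ne_zero _)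
    (e := fun ij => Finsupp.equivFunOnFinite.symm ![ij.1, ij.2]) ?_ ?_
  · rintro ⟨i, j⟩ ⟨i', j'⟩ h
    have h := Finsupp.equivFunOnFinite.symm.injective h
    have h0 := congrFun h 0
    have h1 := congrFun h 1
    simp_all
  · intro t ht
    simp only [MvPolynomial.eval_X] at ht
    obtain ⟨g, h0, h1⟩ : ∃ g : SL(2, K), g.1 0 0 = t 0 ∧ g.1 0 1 = t 1 :=
      ⟨⟨!![t 0, t 1; 0, (t 0)⁻¹], by simp [Matrix.det_fin_two, ht]⟩, rfl, rfl⟩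
    have := congrFun hc g
    rw [Finsupp.linearCombination_apply, Finsupp.sum, Finset.sum_apply] at this
    simpa [Finsupp.sum, rowMono, mono_apply, h0, h1] using this

theorem support_subset_of_linearCombination_rowMono {c : ℕ × ℕ →₀ K} {E : Set (ℕ × ℕ)}
    (h : Finsupp.linearCombination K (rowMono K) c ∈ Submodule.span K (rowMono K '' E)) :
    ↑c.support ⊆ E := by
  obtain ⟨l, hl, hlc⟩ := (Finsupp.mem_span_image_iff_linearCombination K).mp h
  rw [← linearIndependent_rowMono hlc]
  exact (Finsupp.mem_supported K l).mp hl

end Independence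

/-! ### Left-stable subspaces are determined by their U-invariants -/

section Classification

variable {K : Type u} [Field K] [CharZero K]

/-- A distinguished monomial of bidegree `ij` and of degree `n` in the second row. -/
def normalMono (K : Type u) [Field K] (n : ℕ) (ij : ℕ × ℕ) : SL(2, K) → K :=
  mono (ij.1 - min ij.1 n) (min ij.1 n) (ij.2 - (n - min ij.1 n)) (n - min ij.1 n)

/-- The span of the monomials of degree less than `n` in the second row. -/
def ltSpan (K : Type u) [Field K] (n : ℕ) : Submodule K (SL(2, K) → K) :=
  Submodule.span K {F | ∃ a a' b b', a' + b' < n ∧ F = mono a a' b b'}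

omit [CharZero K] in
theorem hasLowerTop_of_mem_ltSpan {n : ℕ} {F : SL(2, K) → K} (hF : F ∈ ltSpan K n) :
    HasLowerTop n F 0 := by
  induction hF using Submodule.span_induction with
  | mem F h =>
    obtain ⟨a, a', b, b', h, rfl⟩ := h
    exact (hasLowerTop_mono a a' b b').of_lt h
  | zero => exact .zero n
  | add F G _ _ h₁ h₂ => simpa using h₁.add h₂
  | smul c F _ h => simpa using h.smul c

omit [CharZero K] in
theorem hasLowerTop_linearCombination {n : ℕ} {c : ℕ × ℕ →₀ K}
    (hc : ∀ ij ∈ c.support, n ≤ ij.1 + ij.2) :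
    HasLowerTop n (Finsupp.linearCombination K (normalMono K n) c)
      (Finsupp.linearCombination K (rowMono K) c) := by
  simp only [Finsupp.linearCombination_apply, Finsupp.sum]
  refine .sum fun ij hij => .smul ?_ _
  have h := hc ij hij
  convert hasLowerTop_mono (K := K) (ij.1 - min ij.1 n) (min ij.1 n) (ij.2 - (n - min ij.1 n))
    (n - min ij.1 n) using 1
  · omega
  · rfl
  · rw [show rowMono K ij = mono ij.1 0 ij.2 0 from rfl]
    congr 1 <;> omega

-- Modulo smaller second-row degree, a monomial of second-row degree `n` depends only on its
-- bidegree and can be replaced by the distinguished one.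
omit [CharZero K] in
theorem exists_normalMono_of_mem_ltSpan {n : ℕ} {F : SL(2, K) → K} (hF : F ∈ ltSpan K (n + 1)) :
    ∃ c ∈ Finsupp.supported K K {ij : ℕ × ℕ | n ≤ ij.1 + ij.2},
      F - Finsupp.linearCombination K (normalMono K n) c ∈ ltSpan K n := by
  induction hF using Submodule.span_induction with
  | mem F h =>
    obtain ⟨a, a', b, b', h, rfl⟩ := h
    rcases Nat.lt_succ_iff_lt_or_eq.mp h with h | h
    · exact ⟨0, zero_mem _, by
        rw [map_zero, sub_zero]
        exact Submodule.subset_span ⟨a, a', b, b', h, rfl⟩⟩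
    · refine ⟨Finsupp.single (a + a', b + b') 1, Finsupp.single_mem_supported _ _ ?_, ?_⟩
      · change n ≤ a + a' + (b + b')
        omega
      · rw [Finsupp.linearCombination_single, one_smul]
        have := mono_sub_mono_mem (K := K) (a := a) (a' := a') (b := b) (b' := b')
          (c := a + a' - min (a + a') n) (c' := min (a + a') n)
          (d := b + b' - (n - min (a + a') n)) (d' := n - min (a + a') n)
          (by omega) (by omega) (by omega)
        refine Submodule.span_mono ?_ this
        rintro _ ⟨c, c', d, d', -, -, h₃, rfl⟩
        exact ⟨_, _, _, _, by omega, rfl⟩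
  | zero => exact ⟨0, zero_mem _, by simp⟩
  | add F G _ _ h₁ h₂ =>
    obtain ⟨c, hc, h₁⟩ := h₁
    obtain ⟨d, hd, h₂⟩ := h₂
    refine ⟨c + d, add_mem hc hd, ?_⟩
    rw [map_add, add_sub_add_comm]
    exact add_mem h₁ h₂
  | smul r F _ h =>
    obtain ⟨c, hc, h⟩ := h
    refine ⟨r • c, Submodule.smul_mem _ _ hc, ?_⟩
    rw [map_smul, ← smul_sub]
    exact Submodule.smul_mem _ _ h

omit [CharZero K] in
theorem ltSpan_mono {m n : ℕ} (h : m ≤ n) : ltSpan K m ≤ ltSpan K n := by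
  refine Submodule.span_mono ?_
  rintro _ ⟨a, a', b, b', h', rfl⟩
  exact ⟨_, _, _, _, h'.trans_le h, rfl⟩

omit [CharZero K] in
theorem exists_mem_ltSpan {F : SL(2, K) → K}
    (hF : F ∈ Submodule.span K {F | ∃ a a' b b', F = (mono a a' b b' : SL(2, K) → K)}) :
    ∃ n, F ∈ ltSpan K n := by
  induction hF using Submodule.span_induction with
  | mem F h =>
    obtain ⟨a, a', b, b', rfl⟩ := h
    exact ⟨a' + b' + 1, Submodule.subset_span ⟨_, _, _, _, Nat.lt_succ_self _, rfl⟩⟩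
  | zero => exact ⟨0, zero_mem _⟩
  | add F G _ _ h₁ h₂ =>
    obtain ⟨m, h₁⟩ := h₁
    obtain ⟨n, h₂⟩ := h₂
    exact ⟨max m n, add_mem (ltSpan_mono (le_max_left _ _) h₁) (ltSpan_mono (le_max_right _ _) h₂)⟩
  | smul c F _ h =>
    obtain ⟨n, h⟩ := h
    exact ⟨n, Submodule.smul_mem _ _ h⟩

/-- The span of the monomials whose bidegree lies in `E`. -/
def bidegreeSpan (K : Type u) [Field K] (E : Set (ℕ × ℕ)) : Submodule K (SL(2, K) → K) :=
  Submodule.span K {F | ∃ a a' b b', (a + a', b + b') ∈ E ∧ F = mono a a' b b'}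

/-- A subspace of `K[SL(2)]` that is stable under left translations is determined by its invariants
under the lower unitriangular matrices. -/
theorem eq_bidegreeSpan {S : Submodule K (SL(2, K) → K)}
    (hS : ∀ g, ∀ F ∈ S, (fun x => F (g * x)) ∈ S)
    (hreg : S ≤ Submodule.span K {F | ∃ a a' b b', F = (mono a a' b b' : SL(2, K) → K)})
    {E : Set (ℕ × ℕ)} (hE : ∀ i j, (i + 1, j + 1) ∈ E → (i, j) ∈ E)
    (hES : Submodule.span K (rowMono K '' E) ≤ S)
    (hU : S ⊓ Submodule.span K (Set.range (rowMono K)) ≤ Submodule.span K (rowMono K '' E)) :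
    S = bidegreeSpan K E := by
  have hle : bidegreeSpan K E ≤ S := by
    refine Submodule.span_le.mpr ?_
    rintro _ ⟨a, a', b, b', h, rfl⟩
    exact mono_mem_of_bidegree S hS E hE
      (fun i j hij => hES (Submodule.subset_span ⟨(i, j), hij, rfl⟩)) a a' b b' h
  refine le_antisymm (fun F hF => ?_) hle
  obtain ⟨n, hn⟩ := exists_mem_ltSpan (hreg hF)
  induction n generalizing F with
  | zero =>
    have : F = 0 := by simpa [ltSpan] using hn
    rw [this]
    exact zero_mem _
  | succ n ih =>
    obtain ⟨c, hc, hcF⟩ := exists_normalMono_of_mem_ltSpan hn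
    have hcn : ∀ ij ∈ c.support, n ≤ ij.1 + ij.2 := fun ij h => (Finsupp.mem_supported _ _).mp hc h
    -- The top coefficient of `F` is the same combination with row monomials in place of
    -- distinguished ones. It lies in `S`, so `hU` and linear independence force the exponents into
    -- `E`; subtracting the distinguished part lowers the second-row degree.
    have htop := (hasLowerTop_of_mem_ltSpan hcF).add (hasLowerTop_linearCombination hcn)
    rw [sub_add_cancel, zero_add] at htop
    have hcE : ↑c.support ⊆ E := support_subset_of_linearCombination_rowMono
      (hU ⟨htop.mem hS hF, (Finsupp.range_linearCombination K (v := rowMono K)).le ⟨c, rfl⟩⟩)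
    have hmem : Finsupp.linearCombination K (normalMono K n) c ∈ bidegreeSpan K E := by
      rw [Finsupp.linearCombination_apply]
      refine sum_mem fun ij hij => Submodule.smul_mem _ _ (Submodule.subset_span
        ⟨_, _, _, _, ?_, rfl⟩)
      -- The truncated subtractions in `normalMono` are exact because `n ≤ ij.1 + ij.2`, so its
      -- bidegree really is `ij`.
      have h := hcE hij
      have h' := hcn ij hij
      convert h using 1
      ext <;> simp only <;> omega
    rw [← sub_add_cancel F (Finsupp.linearCombination K (normalMono K n) c)]
    exact add_mem (ih _ (sub_mem hF (hle hmem)) hcF) hmem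

end Classification

/-! ### The torus action on a semigroup algebra -/

section Torus

variable {K : Type u} [Field K] {n : ℕ}

theorem character_add (m m' : Fin n → ℤ) (t : Fin n → Kˣ) :
    character (m + m') t = character m t * character m' t := by
  simp [character, zpow_add, Finset.prod_mul_distrib]

@[simp]
theorem character_zero (t : Fin n → Kˣ) : character 0 t = 1 := by simp [character]

theorem character_mul (m : Fin n → ℤ) (s t : Fin n → Kˣ) :
    character m (s * t) = character m s * character m t := by
  simp [character, mul_zpow, Finset.prod_mul_distrib]

@[simp]
theorem character_one (m : Fin n → ℤ) : character m (1 : Fin n → Kˣ) = 1 := by simp [character]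

theorem character_mem_torusFunctions (m : Fin n → ℤ) :
    (fun t => (character m t : K)) ∈ torusFunctions K n := by
  have h : (fun t => (character m t : K)) =
      ∏ i, fun t : Fin n → Kˣ => ((t i ^ m i : Kˣ) : K) := by
    ext t
    simp [character]
  rw [h]
  refine prod_mem fun i _ => ?_
  cases m i with
  | ofNat k =>
    have : (fun t : Fin n → Kˣ => ((t i : Kˣ) : K)) ∈ torusFunctions K n :=
      Algebra.subset_adjoin (Or.inl ⟨i, rfl⟩)
    convert pow_mem this k using 1
    ext t
    simp
  | negSucc k =>
    have : (fun t : Fin n → Kˣ => ((t i)⁻¹ : K)) ∈ torusFunctions K n :=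
      Algebra.subset_adjoin (Or.inr ⟨i, rfl⟩)
    convert pow_mem this (k + 1) using 1
    ext t
    simp [zpow_negSucc]

variable {P : AddSubmonoid (Fin n → ℤ)}

theorem addMonoidAlgebra_algHom_ext {B : Type v} [CommRing B] [Algebra K B]
    {φ ψ : AddMonoidAlgebra K P →ₐ[K] B}
    (h : ∀ m, φ (AddMonoidAlgebra.single m 1) = ψ (AddMonoidAlgebra.single m 1)) : φ = ψ :=
  AddMonoidAlgebra.algHom_ext h (Subsingleton.elim _ _)

/-- The torus element `t` acts on a semigroup algebra by scaling the basis element of `m` by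
`χ^m(t)`. -/
noncomputable def charScale (P : AddSubmonoid (Fin n → ℤ)) (t : Fin n → Kˣ) :
    AddMonoidAlgebra K P →ₐ[K] AddMonoidAlgebra K P :=
  AddMonoidAlgebra.lift K _ P
    { toFun := fun m => AddMonoidAlgebra.single m.toAdd (character m.toAdd.1 t : K)
      map_one' := by simp [AddMonoidAlgebra.one_def]
      map_mul' := fun a b => by simp [AddMonoidAlgebra.single_mul_single, character_add] }

theorem charScale_single (t : Fin n → Kˣ) (m : P) (r : K) :
    charScale P t (AddMonoidAlgebra.single m r) =
      AddMonoidAlgebra.single m (r * (character m.1 t : K)) := by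
  simp [charScale]

theorem charScale_mul (s t : Fin n → Kˣ) :
    charScale P (s * t) = (charScale P s : AddMonoidAlgebra K P →ₐ[K] _).comp (charScale P t) := by
  apply addMonoidAlgebra_algHom_ext
  intro m
  simp [charScale_single, character_mul, mul_comm]

theorem charScale_one : charScale P (1 : Fin n → Kˣ) = AlgHom.id K (AddMonoidAlgebra K P) := by
  apply addMonoidAlgebra_algHom_ext
  intro m
  simp [charScale_single]

variable {A : Type v} [CommRing A] [Algebra K A] (e : AddMonoidAlgebra K P ≃ₐ[K] A)

/-- The torus action on functions transported along a presentation as a semigroup algebra. -/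
noncomputable def charScaleOf (t : Fin n → Kˣ) : A →ₐ[K] A :=
  (e : AddMonoidAlgebra K P →ₐ[K] A).comp ((charScale P t).comp (e.symm : A →ₐ[K] _))

theorem charScaleOf_apply (t : Fin n → Kˣ) (f : AddMonoidAlgebra K P) :
    charScaleOf e t (e f) = e (charScale P t f) := by
  simp [charScaleOf]

theorem charScaleOf_mul (s t : Fin n → Kˣ) (f : A) :
    charScaleOf e (s * t) f = charScaleOf e s (charScaleOf e t f) := by
  obtain ⟨f, rfl⟩ := e.surjective f
  simp [charScaleOf_apply, charScale_mul]

theorem charScaleOf_one (f : A) : charScaleOf e 1 f = f := by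
  obtain ⟨f, rfl⟩ := e.surjective f
  simp [charScaleOf_apply, charScale_one]

theorem exists_regular_expansion (f : AddMonoidAlgebra K P) :
    ∃ (k : ℕ) (φ : Fin k → torusFunctions K n) (a : Fin k → A),
      ∀ (t : Fin n → Kˣ) (x : Pts K A),
        x (e (charScale P t f)) = ∑ i, (φ i : (Fin n → Kˣ) → K) t * x (a i) := by
  induction f using AddMonoidAlgebra.induction_linear with
  | zero => exact ⟨0, Fin.elim0, Fin.elim0, by simp⟩
  | add f g hf hg =>
    obtain ⟨k, φ, a, h⟩ := hf
    obtain ⟨k', φ', a', h'⟩ := hg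
    refine ⟨k + k', Fin.append φ φ', Fin.append a a', fun t x => ?_⟩
    simp [Fin.sum_univ_add, h, h']
  | single m r =>
    refine ⟨1, fun _ => ⟨_, character_mem_torusFunctions m.1⟩,
      fun _ => e (AddMonoidAlgebra.single m r), fun t x => ?_⟩
    rw [charScale_single, mul_comm, ← smul_eq_mul, ← AddMonoidAlgebra.smul_single,
      map_smul, map_smul, smul_eq_mul, Fin.sum_univ_one]

/-- The torus action on a variety whose coordinate ring is a semigroup algebra. -/
noncomputable def torusAction : RegularAction (torusFunctions K n) A where
  act :=
    { toFun := fun t =>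
        { toFun := fun x => x.comp (charScaleOf e t)
          invFun := fun x => x.comp (charScaleOf e t⁻¹)
          left_inv := fun x => by
            ext f
            simp [← charScaleOf_mul, charScaleOf_one]
          right_inv := fun x => by
            ext f
            simp [← charScaleOf_mul, charScaleOf_one] }
      map_one' := by
        ext x f
        simp [charScaleOf_one]
      -- Pullback reverses composition; commutativity of the torus restores the order.
      map_mul' := fun s t => by
        ext x f
        simp [mul_comm s t, charScaleOf_mul] }
  regular := fun f => by
    obtain ⟨f, rfl⟩ := e.surjective f
    obtain ⟨k, φ, a, h⟩ := exists_regular_expansion e f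
    exact ⟨k, φ, a, fun t x => by
      rw [← h, ← charScaleOf_apply]
      rfl⟩

theorem torusAction_single (m : P) (t : Fin n → Kˣ) (x : Pts K A) :
    (torusAction e).act t x (e (AddMonoidAlgebra.single m 1)) =
      (character m.1 t : K) * x (e (AddMonoidAlgebra.single m 1)) := by
  change x (charScaleOf e t (e _)) = _
  rw [charScaleOf_apply, charScale_single, one_mul, ← mul_one (character m.1 t : K), ← smul_eq_mul,
    ← AddMonoidAlgebra.smul_single, map_smul, map_smul, smul_eq_mul, smul_eq_mul, mul_one]

end Torus

/-! ### The cone, its dual semigroup and the open torus orbit -/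

section Cone

/-- The cone of the toric variety, for the parameters `s = lq` and `t = lp`. -/
def sl2Cone (s t : ℚ) : PointedCone ℚ (Fin 3 → ℚ) :=
  PointedCone.hull ℚ {![1, 0, 0], ![0, 1, 0], ![-1, 0, s], ![0, -1, t]}

theorem mem_dualMonoid_sl2Cone {s t : ℕ} {m : Fin 3 → ℤ} :
    m ∈ dualMonoid (sl2Cone s t) ↔ 0 ≤ m 0 ∧ 0 ≤ m 1 ∧ m 0 ≤ s * m 2 ∧ m 1 ≤ t * m 2 := by
  constructor
  · intro h
    have h' : ∀ w ∈ sl2Cone (s : ℚ) t, 0 ≤ ∑ i, (m i : ℚ) * w i := h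
    have h₁ := h' ![1, 0, 0] (Submodule.subset_span (by simp))
    have h₂ := h' ![0, 1, 0] (Submodule.subset_span (by simp))
    have h₃ := h' ![-1, 0, s] (Submodule.subset_span (by simp))
    have h₄ := h' ![0, -1, t] (Submodule.subset_span (by simp))
    simp [Fin.sum_univ_three] at h₁ h₂ h₃ h₄
    refine ⟨h₁, h₂, ?_, ?_⟩
    · have : (m 0 : ℚ) ≤ s * m 2 := by linarith
      exact_mod_cast this
    · have : (m 1 : ℚ) ≤ t * m 2 := by linarith
      exact_mod_cast this
  · rintro ⟨h₁, h₂, h₃, h₄⟩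
    have h₁ : (0 : ℚ) ≤ m 0 := by exact_mod_cast h₁
    have h₂ : (0 : ℚ) ≤ m 1 := by exact_mod_cast h₂
    have h₃ : (m 0 : ℚ) ≤ s * m 2 := by exact_mod_cast h₃
    have h₄ : (m 1 : ℚ) ≤ t * m 2 := by exact_mod_cast h₄
    change ∀ w ∈ sl2Cone (s : ℚ) t, 0 ≤ ∑ i, (m i : ℚ) * w i
    intro w hw
    unfold sl2Cone at hw
    induction hw using Submodule.span_induction with
    | mem w hw =>
      simp only [Set.mem_insert_iff, Set.mem_singleton_iff] at hw
      rcases hw with rfl | rfl | rfl | rfl <;> simp [Fin.sum_univ_three] <;> linarith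
    | zero => simp
    | add v w _ _ hv hw =>
      simp only [Pi.add_apply, mul_add, Finset.sum_add_distrib]
      exact add_nonneg hv hw
    | smul c w _ hw =>
      have : ∑ i, (m i : ℚ) * (c • w) i = c * ∑ i, (m i : ℚ) * w i := by
        rw [Finset.mul_sum]
        refine Finset.sum_congr rfl fun i _ => ?_
        change (m i : ℚ) * ((c : ℚ) * w i) = _
        ring
      rw [this]
      exact mul_nonneg c.2 hw

theorem sl2Cone_fg (s t : ℚ) : (sl2Cone s t).FG :=
  Submodule.fg_span (by simp)

/-- Every element of the dual semigroup vanishes on `w`, and (0,0,1), (1,0,1), (0,1,1) already span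
the dual space. -/
theorem sl2Cone_salient {s t : ℕ} (hs : 0 < s) (ht : 0 < t) {w : Fin 3 → ℚ}
    (hw : w ∈ sl2Cone s t) (hw' : -w ∈ sl2Cone s t) : w = 0 := by
  have key : ∀ m : Fin 3 → ℤ, m ∈ dualMonoid (sl2Cone s t) → ∑ i, (m i : ℚ) * w i = 0 := by
    intro m hm
    have h₁ := hm w hw
    have h₂ := hm (-w) hw'
    simp only [Pi.neg_apply, mul_neg, Finset.sum_neg_distrib] at h₂
    linarith
  have h₁ := key ![0, 0, 1] (by rw [mem_dualMonoid_sl2Cone]; simp)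
  have h₂ := key ![1, 0, 1] (by rw [mem_dualMonoid_sl2Cone]; simp; omega)
  have h₃ := key ![0, 1, 1] (by rw [mem_dualMonoid_sl2Cone]; simp; omega)
  simp [Fin.sum_univ_three] at h₁ h₂ h₃
  ext i
  fin_cases i <;> simp <;> linarith

variable {K : Type u} [Field K] {A : Type v} [CommRing A] [Algebra K A] {s t : ℕ}

/-- The elements (0,0,1), (1,0,1), (0,1,1) of the semigroup form a basis of `M`. A point at which
their three characters are nonzero is determined by those values, which the torus can prescribe. -/
theorem torusAction_locallyTransitive (hs : 0 < s) (ht : 0 < t)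
    (e : AddMonoidAlgebra K (dualMonoid (sl2Cone s t)) ≃ₐ[K] A) :
    (torusAction e).LocallyTransitive := by
  let P := dualMonoid (sl2Cone s t)
  let χ : P → A := fun m => e (AddMonoidAlgebra.single m 1)
  have hχ : ∀ m m', χ (m + m') = χ m * χ m' := fun m m' => by
    simp [χ, ← map_mul, AddMonoidAlgebra.single_mul_single]
  have hχn : ∀ (k : ℕ) m, χ (k • m) = χ m ^ k := fun k m => by
    simp [χ, ← map_pow, AddMonoidAlgebra.single_pow]
  let m₀ : P := ⟨![0, 0, 1], by rw [mem_dualMonoid_sl2Cone]; simp⟩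
  let m₁ : P := ⟨![1, 0, 1], by rw [mem_dualMonoid_sl2Cone]; simp; omega⟩
  let m₂ : P := ⟨![0, 1, 1], by rw [mem_dualMonoid_sl2Cone]; simp; omega⟩
  let x₀ : Pts K A := (AddMonoidAlgebra.lift K K P 1).comp (e.symm : A →ₐ[K] _)
  have hx₀ : ∀ m, x₀ (χ m) = 1 := fun m => by simp [x₀, χ]
  refine ⟨x₀, {χ m₀ * χ m₁ * χ m₂}, ?_⟩
  ext x
  simp only [Set.mem_singleton_iff, exists_eq_left, map_mul]
  constructor
  · rintro ⟨τ, rfl⟩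
    change (torusAction e).act τ x₀ (χ m₀) * (torusAction e).act τ x₀ (χ m₁) *
      (torusAction e).act τ x₀ (χ m₂) ≠ 0
    simp only [χ, torusAction_single]
    change _ * x₀ (χ m₀) * (_ * x₀ (χ m₁)) * (_ * x₀ (χ m₂)) ≠ 0
    simp [hx₀]
  · intro hx
    change x (χ m₀) * x (χ m₁) * x (χ m₂) ≠ 0 at hx
    simp only [ne_eq, mul_eq_zero, not_or] at hx
    obtain ⟨⟨h0, h1⟩, h2⟩ := hx
    let τ : Fin 3 → Kˣ := ![Units.mk0 _ h1 / Units.mk0 _ h0, Units.mk0 _ h2 / Units.mk0 _ h0,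
      Units.mk0 _ h0]
    refine ⟨τ, ?_⟩
    have hext : ∀ m, (torusAction e).act τ x₀ (χ m) = x (χ m) := by
      intro m
      rw [torusAction_single]
      change _ * x₀ (χ m) = _
      rw [hx₀, mul_one]
      obtain ⟨g0, g1, g2, g3⟩ := mem_dualMonoid_sl2Cone.mp m.2
      have g4 : 0 ≤ m.1 2 := by
        by_contra hneg
        have : (s : ℤ) * m.1 2 < 0 := mul_neg_of_pos_of_neg (by exact_mod_cast hs) (by omega)
        omega
      obtain ⟨a, ha⟩ := Int.eq_ofNat_of_zero_le g0
      obtain ⟨b, hb⟩ := Int.eq_ofNat_of_zero_le g1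
      obtain ⟨c, hc⟩ := Int.eq_ofNat_of_zero_le g4
      -- In `M` one has m = a m₁ + b m₂ + (c - a - b) m₀; adding (a + b) m₀ keeps all coefficients
      -- in ℕ.
      have hm : m + (a + b) • m₀ = a • m₁ + b • m₂ + c • m₀ := by
        ext i
        fin_cases i <;> simp [m₀, m₁, m₂, ha, hb, hc]
        ring
      have := congrArg (fun m => x (χ m)) hm
      simp only [hχ, hχn, map_mul, map_pow] at this
      have h0' : x (χ m₀) ^ (a + b) ≠ 0 := pow_ne_zero _ h0
      refine mul_right_cancel₀ h0' (Eq.trans ?_ this.symm)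
      simp [character, Fin.prod_univ_three, ha, hb, hc, τ]
      rw [div_pow, div_pow, pow_add]
      field_simp
    have : ∀ f, (torusAction e).act τ x₀ (e f) = x (e f) := by
      have h := addMonoidAlgebra_algHom_ext (φ := ((torusAction e).act τ x₀).comp
        (e : AddMonoidAlgebra K P →ₐ[K] A)) (ψ := x.comp (e : AddMonoidAlgebra K P →ₐ[K] A)) hext
      exact fun f => DFunLike.congr_fun h f
    refine AlgHom.ext fun f => ?_
    obtain ⟨f, rfl⟩ := e.surjective f
    exact this f

theorem isToricWithCone_torusAction (hs : 0 < s) (ht : 0 < t)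
    (e : AddMonoidAlgebra K (dualMonoid (sl2Cone s t)) ≃ₐ[K] A) :
    IsToricWithCone (torusAction e) (sl2Cone s t) :=
  ⟨torusAction_locallyTransitive hs ht e, sl2Cone_fg _ _, fun _ => sl2Cone_salient hs ht, e,
    torusAction_single e⟩

end Cone

/-! ### The semigroup algebra inside the functions on SL(2) -/

section SemigroupEmbedding

variable {K : Type u} [Field K] {s t : ℕ}

theorem nonneg_of_mem_dualMonoid_sl2Cone (hs : 0 < s) {m : Fin 3 → ℤ}
    (hm : m ∈ dualMonoid (sl2Cone s t)) : 0 ≤ m 2 := by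
  obtain ⟨h₀, -, h₂, -⟩ := mem_dualMonoid_sl2Cone.mp hm
  by_contra hneg
  have : (s : ℤ) * m 2 < 0 := mul_neg_of_pos_of_neg (by exact_mod_cast hs) (by omega)
  omega

/-- The function on `SL(2)` that corresponds to an element of the semigroup of the cone. -/
def coneMono (K : Type u) [Field K] (s t : ℕ) (m : Fin 3 → ℤ) : SL(2, K) → K :=
  mono (m 0).toNat (s * m 2 - m 0).toNat (m 1).toNat (t * m 2 - m 1).toNat

/-- On the semigroup all four exponents are nonnegative, and there `Int.toNat` is additive. -/
theorem coneMono_add {m m' : Fin 3 → ℤ} (hm : m ∈ dualMonoid (sl2Cone s t))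
    (hm' : m' ∈ dualMonoid (sl2Cone s t)) :
    coneMono K s t (m + m') = coneMono K s t m * coneMono K s t m' := by
  obtain ⟨h₁, h₂, h₃, h₄⟩ := mem_dualMonoid_sl2Cone.mp hm
  obtain ⟨h₁', h₂', h₃', h₄'⟩ := mem_dualMonoid_sl2Cone.mp hm'
  rw [coneMono, coneMono, coneMono, mono_mul_mono]
  simp only [Pi.add_apply, mul_add]
  congr 1 <;> omega

/-- The homomorphism from the semigroup algebra of the cone to functions on `SL(2)`. -/
noncomputable def coneHom (K : Type u) [Field K] (s t : ℕ) :
    AddMonoidAlgebra K (dualMonoid (sl2Cone s t)) →ₐ[K] (SL(2, K) → K) :=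
  AddMonoidAlgebra.lift K _ _
    { toFun := fun m => coneMono K s t m.toAdd.1
      map_one' := by
        ext g
        simp [coneMono, mono_apply]
      map_mul' := fun a b => coneMono_add a.toAdd.2 b.toAdd.2 }

theorem coneHom_single (m : dualMonoid (sl2Cone s t)) (r : K) :
    coneHom K s t (AddMonoidAlgebra.single m r) = r • coneMono K s t m.1 := by
  simp [coneHom]

theorem coneHom_apply (f : AddMonoidAlgebra K (dualMonoid (sl2Cone s t))) :
    coneHom K s t f = f.coeff.sum fun m r => r • coneMono K s t m.1 := by
  simp [coneHom, AddMonoidAlgebra.lift_apply]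

theorem range_coneHom : (coneHom K s t).range.toSubmodule =
    Submodule.span K {F | ∃ m ∈ dualMonoid (sl2Cone s t), F = coneMono K s t m} := by
  apply le_antisymm
  · rintro _ ⟨f, rfl⟩
    change coneHom K s t f ∈ _
    rw [coneHom_apply]
    exact sum_mem fun m _ => Submodule.smul_mem _ _ (Submodule.subset_span ⟨m.1, m.2, rfl⟩)
  · refine Submodule.span_le.mpr ?_
    rintro _ ⟨m, hm, rfl⟩
    exact ⟨AddMonoidAlgebra.single ⟨m, hm⟩ 1, by
      change coneHom K s t _ = _
      rw [coneHom_single, one_smul]⟩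

/-- The semigroup characters of the cone are realized on `SL(2)`: the torus coordinates may be
prescribed on a nonempty open set. -/
theorem exists_coneMono_eq [IsAlgClosed K] (hst : t < s) {τ : Fin 3 → K} (h₂ : τ 2 ≠ 0)
    (h : τ 0 - τ 1 ≠ 0) : ∃ g : SL(2, K), ∀ m ∈ dualMonoid (sl2Cone s t),
      coneMono K s t m g = τ 0 ^ (m 0).toNat * τ 1 ^ (m 1).toNat * τ 2 ^ (m 2).toNat := by
  -- With α = γτ₀ and β = δτ₁ the determinant condition is γδ(τ₀ - τ₁) = 1. Eliminating δ from γ^s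
  -- δ^t = τ₂ leaves γ^(s-t) = τ₂(τ₀ - τ₁)^t, which is solvable since t < s.
  obtain ⟨γ, hγ⟩ := IsAlgClosed.exists_pow_nat_eq (τ 2 * (τ 0 - τ 1) ^ t) (Nat.sub_pos_of_lt hst)
  have hγ0 : γ ≠ 0 := by
    rintro rfl
    rw [zero_pow (Nat.sub_pos_of_lt hst).ne'] at hγ
    exact mul_ne_zero h₂ (pow_ne_zero _ h) hγ.symm
  obtain ⟨δ, hδ⟩ : ∃ δ : K, γ * δ * (τ 0 - τ 1) = 1 := ⟨(γ * (τ 0 - τ 1))⁻¹, by field_simp⟩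
  have hτ : γ ^ s * δ ^ t = τ 2 := by
    obtain ⟨r, rfl⟩ := Nat.exists_eq_add_of_lt hst
    have hr : t + r + 1 - t = r + 1 := by omega
    rw [hr] at hγ
    calc γ ^ (t + r + 1) * δ ^ t = γ ^ (r + 1) * (γ * δ) ^ t := by ring
      _ = τ 2 * (γ * δ * (τ 0 - τ 1)) ^ t := by
        rw [hγ, mul_pow (γ * δ) (τ 0 - τ 1)]; ring
      _ = τ 2 := by rw [hδ]; simp
  obtain ⟨g, h00, h01, h10, h11⟩ : ∃ g : SL(2, K), g.1 0 0 = γ * τ 0 ∧ g.1 0 1 = δ * τ 1 ∧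
      g.1 1 0 = γ ∧ g.1 1 1 = δ :=
    ⟨⟨!![γ * τ 0, δ * τ 1; γ, δ], by rw [Matrix.det_fin_two_of]; linear_combination hδ⟩,
      rfl, rfl, rfl, rfl⟩
  refine ⟨g, fun m hm => ?_⟩
  have h₅ := nonneg_of_mem_dualMonoid_sl2Cone (by omega) hm
  obtain ⟨h₁, h₂, h₃, h₄⟩ := mem_dualMonoid_sl2Cone.mp hm
  obtain ⟨x, hx⟩ := Int.eq_ofNat_of_zero_le h₁
  obtain ⟨y, hy⟩ := Int.eq_ofNat_of_zero_le h₂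
  obtain ⟨z, hz⟩ := Int.eq_ofNat_of_zero_le h₅
  obtain ⟨x', hx'⟩ := Int.eq_ofNat_of_zero_le (sub_nonneg.mpr h₃)
  obtain ⟨y', hy'⟩ := Int.eq_ofNat_of_zero_le (sub_nonneg.mpr h₄)
  have e₁ : s * z = x + x' := by zify; rw [← hx', hx, hz]; ring
  have e₂ : t * z = y + y' := by zify; rw [← hy', hy, hz]; ring
  rw [coneMono, mono_apply, hx', hy', h00, h01, h10, h11, hx, hy, hz]
  simp only [Int.toNat_natCast]
  rw [← hτ, mul_pow (γ ^ s), ← pow_mul, ← pow_mul, e₁, e₂]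
  ring

theorem coneHom_injective [IsAlgClosed K] (hst : t < s) :
    Function.Injective (coneHom K s t) := by
  have : Infinite K := IsAlgClosed.instInfinite
  rw [injective_iff_map_eq_zero]
  intro f hf
  rw [← AddMonoidAlgebra.coeff_eq_zero]
  refine finsupp_eq_zero_of_forall_eval (σ := Fin 3)
    (q := MvPolynomial.X 2 * (MvPolynomial.X 0 - MvPolynomial.X 1))
    (mul_ne_zero (MvPolynomial.X_ne_zero _) (sub_ne_zero.mpr fun h => ?_))
    (e := fun m => Finsupp.equivFunOnFinite.symm ![(m.1 0).toNat, (m.1 1).toNat, (m.1 2).toNat])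
    ?_ ?_
  · exact absurd (MvPolynomial.X_injective h) (by decide)
  · intro m m' h
    have h := Finsupp.equivFunOnFinite.symm.injective h
    have h0 := congrFun h 0
    have h1 := congrFun h 1
    have h2 := congrFun h 2
    simp only [Matrix.cons_val] at h0 h1 h2
    have hm := nonneg_of_mem_dualMonoid_sl2Cone (by omega) m.2
    have hm' := nonneg_of_mem_dualMonoid_sl2Cone (by omega) m'.2
    obtain ⟨h₁, h₂, -, -⟩ := mem_dualMonoid_sl2Cone.mp m.2
    obtain ⟨h₁', h₂', -, -⟩ := mem_dualMonoid_sl2Cone.mp m'.2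
    ext i
    fin_cases i <;> simp only [Fin.zero_eta, Fin.mk_one, Fin.reduceFinMk] <;> omega
  · intro τ hτ
    simp only [map_mul, map_sub, MvPolynomial.eval_X, mul_ne_zero_iff] at hτ
    obtain ⟨g, hg⟩ := exists_coneMono_eq (K := K) hst hτ.1 hτ.2
    have := congrFun hf g
    rw [coneHom_apply, Finsupp.sum, Finset.sum_apply] at this
    rw [Finsupp.sum, ← Pi.zero_apply (M := fun _ => K) g, ← this]
    refine Finset.sum_congr rfl fun m _ => ?_
    rw [Pi.smul_apply, hg m.1 m.2, smul_eq_mul]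
    simp [Fin.prod_univ_three]

end SemigroupEmbedding

/-! ### Invariants of a cyclic diagonal group -/

section DiagonalInvariants

variable {K : Type u} [Field K]

/-- The embedding of the multiplicative group as the diagonal matrices of `SL(2)`. -/
def diagHom (K : Type u) [Field K] : Kˣ →* SL(2, K) where
  toFun ζ := ⟨!![(ζ : K), 0; 0, (ζ⁻¹ : Kˣ)], by simp⟩
  map_one' := by
    ext i j
    fin_cases i <;> fin_cases j <;> simp
  map_mul' a b := Subtype.ext <| by
    change !![((a * b : Kˣ) : K), 0; 0, ((a * b)⁻¹ : Kˣ)] =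
      !![(a : K), 0; 0, (a⁻¹ : Kˣ)] * !![(b : K), 0; 0, (b⁻¹ : Kˣ)]
    simp [mul_comm]

@[simp] theorem diagHom_zero_zero (ζ : Kˣ) : (diagHom K ζ).1 0 0 = ζ := rfl
@[simp] theorem diagHom_zero_one (ζ : Kˣ) : (diagHom K ζ).1 0 1 = 0 := rfl
@[simp] theorem diagHom_one_zero (ζ : Kˣ) : (diagHom K ζ).1 1 0 = 0 := rfl
@[simp] theorem diagHom_one_one (ζ : Kˣ) : (diagHom K ζ).1 1 1 = (ζ⁻¹ : Kˣ) := rfl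

theorem diagHom_injective : Function.Injective (diagHom K) := fun _ _ h =>
  Units.ext (congrArg (fun g : SL(2, K) => g.1 0 0) h)

theorem mono_mul_diagHom (a a' b b' : ℕ) (ζ : Kˣ) (g : SL(2, K)) :
    mono a a' b b' (g * diagHom K ζ) =
      ((ζ ^ (a + a') * ζ⁻¹ ^ (b + b') : Kˣ) : K) * mono a a' b b' g := by
  simp only [mono_apply, sl2_mul_apply, diagHom_zero_zero, diagHom_zero_one, diagHom_one_zero,
    diagHom_one_one, mul_zero, add_zero, zero_add]
  push_cast
  ring

/-- Averaging over the powers of a diagonal matrix kills the monomials that are not invariant. -/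
theorem mem_bidegreeSpan_of_diag_invariant [CharZero K] {E : Set (ℕ × ℕ)} {ζ : Kˣ} {r : ℕ}
    (hr : 0 < r) (hζ : ζ ^ r = 1) {F : SL(2, K) → K} (hF : F ∈ bidegreeSpan K E)
    (hinv : ∀ g, F (g * diagHom K ζ) = F g) :
    F ∈ bidegreeSpan K {ij ∈ E | ζ ^ ij.1 = ζ ^ ij.2} := by
  let avg : (SL(2, K) → K) →ₗ[K] (SL(2, K) → K) :=
    ∑ k ∈ Finset.range r, LinearMap.funLeft K K (fun g => g * diagHom K ζ ^ k)
  have havg : ∀ F g, avg F g = ∑ k ∈ Finset.range r, F (g * diagHom K ζ ^ k) := fun F g => by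
    simp [avg]
  have hE : ∀ F ∈ bidegreeSpan K E, avg F ∈ bidegreeSpan K {ij ∈ E | ζ ^ ij.1 = ζ ^ ij.2} := by
    intro F hF
    induction hF using Submodule.span_induction with
    | mem F h =>
      obtain ⟨a, a', b, b', h, rfl⟩ := h
      set ω : Kˣ := ζ ^ (a + a') * ζ⁻¹ ^ (b + b') with hω
      have hωr : (ω : K) ^ r = 1 := by
        rw [← Units.val_pow_eq_pow_val, hω, mul_pow, ← pow_mul, ← pow_mul, mul_comm _ r,
          mul_comm _ r, pow_mul, pow_mul, inv_pow, hζ]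
        simp
      have hk : ∀ (k : ℕ) g, mono a a' b b' (g * diagHom K ζ ^ k) =
          (ω : K) ^ k * mono a a' b b' g := by
        intro k
        induction k with
        | zero => simp
        | succ k ih =>
          intro g
          rw [pow_succ, ← mul_assoc, mono_mul_diagHom, ih, pow_succ, ← hω]
          ring
      have hsum : avg (mono a a' b b') = (∑ k ∈ Finset.range r, (ω : K) ^ k) • mono a a' b b' := by
        ext g
        simp [havg, hk, Finset.sum_mul]
      rw [hsum]
      -- `ω` is an `r`-th root of unity, so the sum of its powers vanishes unless `ω = 1`.
      by_cases h1 : (ω : K) = 1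
      · refine Submodule.smul_mem _ _ (Submodule.subset_span ⟨a, a', b, b', ⟨h, ?_⟩, rfl⟩)
        have : ω = 1 := Units.ext h1
        rw [hω, inv_pow, mul_inv_eq_one] at this
        exact this
      · rw [geom_sum_eq h1, hωr]
        simp
    | zero => rw [map_zero]; exact zero_mem _
    | add F G _ _ h₁ h₂ => rw [map_add]; exact add_mem h₁ h₂
    | smul c F _ h => rw [map_smul]; exact Submodule.smul_mem _ _ h
  have hpow : ∀ (k : ℕ) g, F (g * diagHom K ζ ^ k) = F g := by
    intro k
    induction k with
    | zero => simp
    | succ k ih =>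
      intro g
      rw [pow_succ, ← mul_assoc, hinv, ih]
  have : avg F = (r : K) • F := by
    ext g
    simp [havg, hpow]
  have h := hE F hF
  rw [this] at h
  exact (Submodule.smul_mem_iff _ (Nat.cast_ne_zero.mpr hr.ne')).mp h

/-- Multiplication by (αδ - βγ)^k = 1 rewrites a monomial through monomials whose bidegree is larger
by (k, k). -/
theorem mono_mem_of_det_mul (W : Submodule K (SL(2, K) → K)) {i j : ℕ} (k : ℕ)
    (hW : ∀ c c' d d', c + c' = i + k → d + d' = j + k → mono c c' d d' ∈ W) (a a' b b' : ℕ)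
    (h₁ : a + a' = i) (h₂ : b + b' = j) : mono a a' b b' ∈ W := by
  induction k generalizing i j a a' b b' with
  | zero => exact hW _ _ _ _ h₁ h₂
  | succ k ih =>
    rw [← mono_det]
    have hW' : ∀ c c' d d', c + c' = i + 1 + k → d + d' = j + 1 + k → mono c c' d d' ∈ W :=
      fun c c' d d' h h' => hW c c' d d' (by omega) (by omega)
    exact sub_mem (ih hW' _ _ _ _ (by omega) (by omega)) (ih hW' _ _ _ _ (by omega) (by omega))

/-- The exponents of the monomials of height at most `p / q`. -/
def heightSet (p q : ℕ) : Set (ℕ × ℕ) := {ij | q * ij.2 ≤ p * ij.1}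

/-- The invariants of a cyclic group of diagonal matrices form the semigroup algebra of the cone. -/
theorem mem_range_coneHom_iff [CharZero K] {p q l : ℕ} (hpq : p < q) (hl : 0 < l) {ζ : Kˣ}
    (hζ : IsPrimitiveRoot ζ (l * (q - p))) (F : SL(2, K) → K) :
    F ∈ (coneHom K (l * q) (l * p)).range ↔
      F ∈ bidegreeSpan K (heightSet p q) ∧ ∀ g, F (g * diagHom K ζ) = F g := by
  have hq0 : 0 < q := by omega
  change F ∈ (coneHom K (l * q) (l * p)).range.toSubmodule ↔ _
  rw [range_coneHom]
  constructor
  · intro hF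
    induction hF using Submodule.span_induction with
    | mem F h =>
      obtain ⟨m, hm, rfl⟩ := h
      have h₅ := nonneg_of_mem_dualMonoid_sl2Cone (Nat.mul_pos hl hq0) hm
      obtain ⟨h₁, h₂, h₃, h₄⟩ := mem_dualMonoid_sl2Cone.mp hm
      obtain ⟨z, hz⟩ := Int.eq_ofNat_of_zero_le h₅
      have e₁ : (m 0).toNat + ((l * q : ℕ) * m 2 - m 0).toNat = l * q * z := by
        refine Nat.cast_injective (R := ℤ) ?_
        rw [Nat.cast_add, Int.toNat_of_nonneg h₁, Int.toNat_of_nonneg (sub_nonneg.mpr h₃), hz]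
        push_cast
        ring
      have e₂ : (m 1).toNat + ((l * p : ℕ) * m 2 - m 1).toNat = l * p * z := by
        refine Nat.cast_injective (R := ℤ) ?_
        rw [Nat.cast_add, Int.toNat_of_nonneg h₂, Int.toNat_of_nonneg (sub_nonneg.mpr h₄), hz]
        push_cast
        ring
      refine ⟨Submodule.subset_span ⟨_, _, _, _, ?_, rfl⟩, fun g => ?_⟩
      · rw [e₁, e₂]
        change q * (l * p * z) ≤ p * (l * q * z)
        exact (by ring : q * (l * p * z) = p * (l * q * z)).le
      · rw [coneMono, mono_mul_diagHom, e₁, e₂]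
        have : ζ ^ (l * q * z) * ζ⁻¹ ^ (l * p * z) = 1 := by
          have e : l * q * z = l * (q - p) * z + l * p * z := by
            rw [← add_mul, ← mul_add, Nat.sub_add_cancel hpq.le]
          rw [e, pow_add, mul_assoc, ← mul_pow, mul_inv_cancel, one_pow, mul_one, pow_mul,
            hζ.pow_eq_one, one_pow]
        rw [this, Units.val_one, one_mul]
    | zero => exact ⟨zero_mem _, fun _ => rfl⟩
    | add F G _ _ h₁ h₂ =>
      exact ⟨add_mem h₁.1 h₂.1, fun g => by simp [h₁.2 g, h₂.2 g]⟩
    | smul c F _ h => exact ⟨Submodule.smul_mem _ _ h.1, fun g => by simp [h.2 g]⟩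
  · rintro ⟨hF, hinv⟩
    have h := mem_bidegreeSpan_of_diag_invariant (Nat.mul_pos hl (Nat.sub_pos_of_lt hpq))
      hζ.pow_eq_one hF hinv
    refine Submodule.span_le.mpr ?_ h
    rintro _ ⟨a, a', b, b', ⟨h₁, h₂⟩, rfl⟩
    change q * (b + b') ≤ p * (a + a') at h₁
    change ζ ^ (a + a') = ζ ^ (b + b') at h₂
    -- From here q = p + d + 1, so the gap q - p is d + 1.
    obtain ⟨d, rfl⟩ := Nat.exists_eq_add_of_lt hpq
    have hd : p + d + 1 - p = d + 1 := by omega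
    rw [hd] at hζ
    have hle : b + b' ≤ a + a' := by
      by_contra hcon
      have hlt : a + a' < b + b' := by omega
      nlinarith
    obtain ⟨n, hn⟩ := Nat.exists_eq_add_of_le hle
    rw [hn, pow_add, mul_eq_left] at h₂
    obtain ⟨z, rfl⟩ := hζ.dvd_of_pow_eq_one _ h₂
    -- With i = j + l(q - p)z, the condition qj ≤ pi becomes (q - p)j ≤ (q - p)lpz. The difference k
    -- = lpz - j is the power of the determinant needed to reach bidegree (lqz, lpz).
    have hjz : b + b' ≤ l * p * z := by
      rw [hn] at h₁
      have : (d + 1) * (b + b') ≤ (d + 1) * (l * p * z) := by nlinarith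
      exact Nat.le_of_mul_le_mul_left this (Nat.succ_pos d)
    obtain ⟨k, hk⟩ := Nat.exists_eq_add_of_le hjz
    refine mono_mem_of_det_mul _ k (fun c c' e e' hc he => ?_) a a' b b' rfl rfl
    have hc' : c + c' = l * (p + d + 1) * z := by
      rw [hc, hn]
      linarith
    have he' : e + e' = l * p * z := by rw [he, hk]
    have hcZ : ((l * (p + d + 1) : ℕ) : ℤ) * z = c + c' := by exact_mod_cast hc'.symm
    have heZ : ((l * p : ℕ) : ℤ) * z = e + e' := by exact_mod_cast he'.symm
    refine Submodule.subset_span ⟨![(c : ℤ), e, z], mem_dualMonoid_sl2Cone.mpr ?_, ?_⟩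
    · simp only [Matrix.cons_val]
      rw [hcZ, heZ]
      omega
    · simp only [coneMono, Matrix.cons_val]
      rw [hcZ, heZ]
      simp

end DiagonalInvariants

/-! ### Diagonalization by upper unitriangular matrices -/

section Normalization

variable {K : Type u} [Field K]

/-- The shift fixes α and sends β to β + sα, so it only trades powers of β for powers of α. -/
theorem rowMono_mul_upperElem_mem {E : Set (ℕ × ℕ)}
    (hE : ∀ i j, (i, j + 1) ∈ E → (i + 1, j) ∈ E) (s : K) {F : SL(2, K) → K}
    (hF : F ∈ Submodule.span K (rowMono K '' E)) :
    (fun g => F (g * upperElem s)) ∈ Submodule.span K (rowMono K '' E) := by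
  have hshift : ∀ i j k, k ≤ j → (i, j) ∈ E → (i + k, j - k) ∈ E := by
    intro i j k hk h
    induction k with
    | zero => exact h
    | succ k ih =>
      have := ih (by omega)
      rw [show j - k = j - (k + 1) + 1 by omega] at this
      exact hE _ _ this
  induction hF using Submodule.span_induction with
  | mem F h =>
    obtain ⟨⟨i, j⟩, h, rfl⟩ := h
    have : (fun g => rowMono K (i, j) (g * upperElem s)) =
        ∑ k ∈ Finset.range (j + 1), (s ^ k * (j.choose k : K)) • rowMono K (i + k, j - k) := by
      ext g
      rw [Finset.sum_apply]
      simp only [rowMono, mono_apply, sl2_mul_apply, upperElem_zero_zero, upperElem_zero_one,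
        upperElem_one_zero, upperElem_one_one, mul_one, mul_zero, add_zero, pow_zero,
        Pi.smul_apply, smul_eq_mul]
      rw [add_pow, Finset.mul_sum]
      refine Finset.sum_congr rfl fun k _ => ?_
      ring
    rw [this]
    refine sum_mem fun k hk => Submodule.smul_mem _ _ (Submodule.subset_span ⟨_, ?_, rfl⟩)
    exact hshift i j k (Nat.lt_succ_iff.mp (Finset.mem_range.mp hk)) h
  | zero => exact zero_mem _
  | add F G _ _ h₁ h₂ => exact add_mem h₁ h₂
  | smul c F _ h => exact Submodule.smul_mem _ c h

theorem upperElem_mul_neg (s : K) : upperElem s * upperElem (-s) = 1 := by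
  ext i j
  rw [sl2_mul_apply]
  fin_cases i <;> fin_cases j <;> simp

/-- An upper triangular matrix of finite order is diagonalized by an upper unitriangular matrix. -/
theorem exists_upperElem_mul_eq [CharZero K] {c : SL(2, K)} (hc : c.1 1 0 = 0) {r : ℕ} (hr : 0 < r)
    (hcr : c ^ r = 1) : ∃ (s : K) (ζ : Kˣ), upperElem s * c = diagHom K ζ * upperElem s := by
  have hdet : c.1 0 0 * c.1 1 1 = 1 := by
    have := sl2_det c
    rwa [hc, mul_zero, sub_zero] at this
  have h0 : c.1 0 0 ≠ 0 := left_ne_zero_of_mul_eq_one hdet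
  have hinv : (c.1 0 0)⁻¹ = c.1 1 1 := inv_eq_of_mul_eq_one_right hdet
  obtain ⟨s, hs⟩ : ∃ s : K, c.1 0 1 + s * c.1 1 1 = c.1 0 0 * s := by
    by_cases h : c.1 0 0 = c.1 1 1
    -- With equal diagonal entries a, the corner of `c ^ n` is n a^(n-1) times that of `c`; the
    -- factor `c.1 0 0` avoids the exponent n - 1. Finite order in characteristic zero then makes
    -- the corner zero.
    · have hpow : ∀ n : ℕ, (c ^ n).1 1 0 = 0 ∧ (c ^ n).1 0 0 = c.1 0 0 ^ n ∧
          c.1 0 0 * (c ^ n).1 0 1 = n * c.1 0 0 ^ n * c.1 0 1 := by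
        intro n
        induction n with
        | zero => simp
        | succ n ih =>
          obtain ⟨h₁, h₂, h₃⟩ := ih
          rw [pow_succ, sl2_mul_apply, sl2_mul_apply, sl2_mul_apply, hc, h₁, h₂]
          refine ⟨by ring, by ring, ?_⟩
          rw [← h]
          push_cast
          linear_combination c.1 0 0 * h₃
      have hb := (hpow r).2.2
      rw [hcr] at hb
      have hb : (r : K) * c.1 0 0 ^ r * c.1 0 1 = 0 := by rw [← hb]; simp
      have hb : c.1 0 1 = 0 := (mul_eq_zero.mp hb).resolve_left
        (mul_ne_zero (Nat.cast_ne_zero.mpr hr.ne') (pow_ne_zero _ h0))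
      exact ⟨0, by simp [hb]⟩
    · have hne : c.1 0 0 - c.1 1 1 ≠ 0 := sub_ne_zero.mpr h
      refine ⟨c.1 0 1 / (c.1 0 0 - c.1 1 1), ?_⟩
      field_simp
      ring
  refine ⟨s, Units.mk0 _ h0, ?_⟩
  ext i j
  rw [sl2_mul_apply, sl2_mul_apply]
  fin_cases i <;> fin_cases j <;> simp [hc, hs, hinv]

end Normalization

/-! ### The exponent set of height p/q -/

section HeightSet

variable {p q : ℕ}

theorem heightSet_pred (hpq : p < q) (i j : ℕ) (h : (i + 1, j + 1) ∈ heightSet p q) :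
    (i, j) ∈ heightSet p q := by
  change q * (j + 1) ≤ p * (i + 1) at h
  change q * j ≤ p * i
  rw [mul_add, mul_add] at h
  omega

theorem heightSet_shift (i j : ℕ) (h : (i, j + 1) ∈ heightSet p q) :
    (i + 1, j) ∈ heightSet p q := by
  change q * (j + 1) ≤ p * i at h
  change q * j ≤ p * (i + 1)
  rw [mul_add] at h ⊢
  omega

theorem rowMono_image_heightSet (K : Type u) [Field K] (hq : 0 < q) :
    {m : SL(2, K) → K | ∃ i j : ℕ, (j : ℚ) ≤ (p : ℚ) / q * i ∧
        m = fun g => g.1 0 0 ^ i * g.1 0 1 ^ j} = rowMono K '' heightSet p q := by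
  have hiff : ∀ i j : ℕ, (j : ℚ) ≤ (p : ℚ) / q * i ↔ (i, j) ∈ heightSet p q := by
    intro i j
    change _ ↔ q * j ≤ p * i
    have hq' : (0 : ℚ) < q := by exact_mod_cast hq
    rw [div_mul_eq_mul_div, le_div_iff₀ hq', mul_comm (j : ℚ)]
    exact_mod_cast Iff.rfl
  have hmono : ∀ i j : ℕ, rowMono K (i, j) = fun g => g.1 0 0 ^ i * g.1 0 1 ^ j := by
    intro i j
    ext g
    simp [rowMono, mono_apply]
  ext m
  constructor
  · rintro ⟨i, j, h, rfl⟩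
    exact ⟨(i, j), (hiff i j).mp h, hmono i j⟩
  · rintro ⟨⟨i, j⟩, h, rfl⟩
    exact ⟨i, j, (hiff i j).mpr h, hmono i j⟩

end HeightSet

/-! ### Coordinate rings of SL(2)-embeddings -/

section Embeddings

variable {K : Type u} [Field K] [IsAlgClosed K] [CharZero K] {B : Type v} [CommRing B] [IsDomain B]
  [Algebra K B] [Algebra.FiniteType K B] (ρ : RegularAction (sl2Functions K) B)

omit [IsAlgClosed K] [CharZero K] [IsDomain B] [Algebra.FiniteType K B] in
theorem exists_orbitMap_act_eq (y : Pts K B) (u : SL(2, K)) {F : SL(2, K) → K}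
    (hF : F ∈ (ρ.orbitMap y).range) : (fun g => F (g * u)) ∈ (ρ.orbitMap (ρ.act u y)).range := by
  obtain ⟨f, rfl⟩ := hF
  exact ⟨f, by ext g; simp⟩

/-- The functions in the image of an orbit map that depend on the first row only are spanned by the
monomials with exponents in `E`. -/
def HasRowMonomials (y : Pts K B) (E : Set (ℕ × ℕ)) : Prop :=
  Submodule.span K (rowMono K '' E) ≤ (ρ.orbitMap y).range.toSubmodule ∧
    (ρ.orbitMap y).range.toSubmodule ⊓ Submodule.span K (Set.range (rowMono K)) ≤
      Submodule.span K (rowMono K '' E)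

-- Moving the base point by a matrix right-translates the image of the orbit map. Translation by
-- `upperElem s` is inverted by that of `-s`, and both preserve the two spans of row monomials.
omit [IsAlgClosed K] [CharZero K] [IsDomain B] [Algebra.FiniteType K B] in
variable {ρ} in
theorem HasRowMonomials.act {y : Pts K B} {E : Set (ℕ × ℕ)} (h : HasRowMonomials ρ y E)
    (hE : ∀ i j, (i, j + 1) ∈ E → (i + 1, j) ∈ E) (s : K) :
    HasRowMonomials ρ (ρ.act (upperElem s) y) E := by
  have hs : upperElem s * upperElem (-s) = (1 : SL(2, K)) := upperElem_mul_neg s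
  have hs' : upperElem (-s) * upperElem s = (1 : SL(2, K)) := by
    simpa using upperElem_mul_neg (-s)
  have hback : ρ.act (upperElem (-s)) (ρ.act (upperElem s) y) = y := by
    rw [← RegularAction.act_mul, hs']
    simp
  constructor
  · intro F hF
    have h₁ := exists_orbitMap_act_eq ρ y (upperElem s) (h.1 (rowMono_mul_upperElem_mem hE (-s) hF))
    simpa [mul_assoc, hs] using h₁
  · rintro F ⟨hF, hF'⟩
    have h₁ := exists_orbitMap_act_eq ρ _ (upperElem (-s)) hF
    rw [hback] at h₁
    rw [← Set.image_univ] at hF'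
    have h₂ := rowMono_mul_upperElem_mem (fun _ _ _ => Set.mem_univ _) (-s) hF'
    rw [Set.image_univ] at h₂
    have h₃ := rowMono_mul_upperElem_mem hE s (h.2 ⟨h₁, h₂⟩)
    simpa [mul_assoc, hs] using h₃

-- Left multiplication by a lower unitriangular matrix fixes the first row, so a regular function
-- that pulls back to a combination of row monomials is U-invariant on the dense orbit, hence
-- everywhere.
omit [CharZero K] in
theorem hasRowMonomials_of_image_eq {y : Pts K B} (hy : IsZariskiOpen (ρ.orbit y))
    {E : Set (ℕ × ℕ)}
    (h : (fun (f : B) (g : SL(2, K)) => ρ.act g y f) '' ρ.invariants (lowerUnipotent K) =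
      (Submodule.span K (rowMono K '' E) : Set (SL(2, K) → K))) :
    HasRowMonomials ρ y E := by
  constructor
  · intro F hF
    rw [← SetLike.mem_coe, ← h] at hF
    obtain ⟨f, -, rfl⟩ := hF
    exact ⟨f, rfl⟩
  · rintro _ ⟨⟨f, rfl⟩, hF⟩
    rw [← SetLike.mem_coe, ← h]
    refine ⟨f, ρ.mem_invariants_of_orbitMap hy ?_, rfl⟩
    rintro u ⟨h00, h01, h11⟩ g
    change ρ.orbitMap y f ∈ _ at hF
    generalize ρ.orbitMap y f = F at hF
    induction hF using Submodule.span_induction with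
    | mem F h =>
      obtain ⟨ij, rfl⟩ := h
      simp [rowMono, mono_apply, sl2_mul_apply, h00, h01]
    | zero => rfl
    | add F G _ _ h₁ h₂ => simp [h₁, h₂]
    | smul c F _ h => simp [h]

omit [IsAlgClosed K] [IsDomain B] [Algebra.FiniteType K B] in
variable {ρ} in
theorem HasRowMonomials.range_orbitMap {y : Pts K B} {E : Set (ℕ × ℕ)} (h : HasRowMonomials ρ y E)
    (hE : ∀ i j, (i + 1, j + 1) ∈ E → (i, j) ∈ E) :
    (ρ.orbitMap y).range.toSubmodule = bidegreeSpan K E := by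
  refine eq_bidegreeSpan (fun g F hF => ρ.translate_mem_range_orbitMap y hF g) ?_ hE h.1 h.2
  rintro _ ⟨f, rfl⟩
  exact sl2Functions_le_span_mono (ρ.orbitMap_mem y f)

omit [CharZero K] [IsDomain B] [Algebra.FiniteType K B] in
/-- A matrix that normalizes the image of the orbit map is upper triangular. -/
theorem HasRowMonomials.apply_one_zero_eq_zero {y : Pts K B} {E : Set (ℕ × ℕ)}
    (h : HasRowMonomials ρ y E) (h10 : (1, 0) ∈ E) (h01 : (0, 1) ∉ E) {c : SL(2, K)}
    (hc : ∀ F ∈ (ρ.orbitMap y).range, (fun g => F (g * c)) ∈ (ρ.orbitMap y).range) :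
    c.1 1 0 = 0 := by
  have h₁ := hc _ (h.1 (Submodule.subset_span ⟨_, h10, rfl⟩))
  -- The shift of α by `c` is c₀₀ α + c₁₀ β; as (0, 1) is not in `E`, the coefficient of β must
  -- vanish.
  have h₂ : (fun g => rowMono K (1, 0) (g * c)) = Finsupp.linearCombination K (rowMono K)
      (Finsupp.single (1, 0) (c.1 0 0) + Finsupp.single (0, 1) (c.1 1 0)) := by
    ext g
    rw [map_add, Finsupp.linearCombination_single, Finsupp.linearCombination_single]
    simp [rowMono, mono_apply, sl2_mul_apply, mul_comm]
  rw [h₂] at h₁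
  have h₃ := support_subset_of_linearCombination_rowMono
    (h.2 ⟨h₁, (Finsupp.range_linearCombination K (v := rowMono K)).le ⟨_, rfl⟩⟩)
  by_contra hne
  refine h01 (h₃ ?_)
  simp [hne]

end Embeddings

/-! ### The quotient by right shifts -/

section Quotient

variable {K : Type u} [Field K] [IsAlgClosed K] [CharZero K]

variable {A : Type v} [CommRing A] [Algebra K A] {B : Type w} [CommRing B] [IsDomain B]
  [Algebra K B] [Algebra.FiniteType K B]

/-- The coordinate ring of the quotient by a cyclic group of right shifts, as a ring of functions on
`SL(2)`, for a suitable base point. -/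
theorem exists_orbitMap_quotient {ρX : RegularAction (sl2Functions K) A}
    {ρ : RegularAction (sl2Functions K) B} {C : Subgroup SL(2, K)} [IsCyclic C] {r : ℕ}
    (hr : 0 < r) (hC : Nat.card C = r) (hquot : IsRightQuotient ρX ρ C) {E : Set (ℕ × ℕ)}
    (hE : ∀ i j, (i, j + 1) ∈ E → (i + 1, j) ∈ E) (h10 : (1, 0) ∈ E) (h01 : (0, 1) ∉ E)
    {y₀ : Pts K B} (hy₀ : IsZariskiOpen (ρ.orbit y₀)) (hrow : HasRowMonomials ρ y₀ E) :
    ∃ (y : Pts K B) (ζ : Kˣ) (π : A →ₐ[K] B), IsZariskiOpen (ρ.orbit y) ∧ HasRowMonomials ρ y E ∧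
      IsPrimitiveRoot ζ r ∧ Function.Injective π ∧
      ∀ f : B, f ∈ Set.range π ↔
        ∀ g, ρ.orbitMap y f (g * diagHom K ζ) = ρ.orbitMap y f g := by
  obtain ⟨y, ⟨hy, -⟩, θ, hθ, π, hπ, hrange, -⟩ := hquot
  have hθ : ∀ (c : C) (f : B) (g : SL(2, K)), ρ.orbitMap y (θ c f) g = ρ.orbitMap y f (g * c) :=
    fun c f g => hθ c g f
  -- The height and the quotient may use different base points; they differ by `g₀`, which
  -- conjugates the group of right shifts.
  obtain ⟨g₀, rfl⟩ := ρ.exists_act_eq hy₀ hy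
  obtain ⟨c₀, hc₀⟩ := IsCyclic.exists_generator (α := C)
  have hord : orderOf (c₀ : SL(2, K)) = r := by
    rw [Subgroup.orderOf_coe, orderOf_eq_card_of_forall_mem_zpowers hc₀, hC]
  have hconj : ∀ F ∈ (ρ.orbitMap y₀).range,
      (fun g => F (g * (g₀⁻¹ * c₀ * g₀))) ∈ (ρ.orbitMap y₀).range := by
    rintro _ ⟨f, rfl⟩
    refine ⟨θ c₀ f, ?_⟩
    ext g
    have := hθ c₀ f (g * g₀⁻¹)
    simp only [RegularAction.orbitMap_act] at this
    simpa [mul_assoc] using this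
  have htri := hrow.apply_one_zero_eq_zero ρ h10 h01 hconj
  have hpow : (g₀⁻¹ * (c₀ : SL(2, K)) * g₀) ^ r = 1 := by
    have := conj_pow (i := r) (a := g₀⁻¹) (b := (c₀ : SL(2, K)))
    rw [inv_inv] at this
    rw [this, ← hord, pow_orderOf_eq_one]
    simp
  obtain ⟨s, ζ, hs⟩ := exists_upperElem_mul_eq htri hr hpow
  -- `g₁` carries the new base point `upperElem s • y₀` to the one of the quotient and conjugates
  -- `diagHom K ζ` to the generator `c₀`.
  set g₁ : SL(2, K) := g₀ * (upperElem s)⁻¹ with hg₁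
  have hc : (c₀ : SL(2, K)) = g₁ * diagHom K ζ * g₁⁻¹ := by
    have : diagHom K ζ = upperElem s * (g₀⁻¹ * c₀ * g₀) * (upperElem s)⁻¹ := by
      rw [hs, mul_inv_cancel_right]
    rw [this, hg₁]
    group
  have hy₁ : ρ.act g₁ (ρ.act (upperElem s) y₀) = ρ.act g₀ y₀ := by
    rw [← RegularAction.act_mul, hg₁, inv_mul_cancel_right]
  refine ⟨ρ.act (upperElem s) y₀, ζ, π, ?_, hrow.act hE s, ?_, hπ, fun f => ?_⟩
  · rwa [ρ.orbit_act]
  · rw [← hord, hc, ← MulAut.conj_apply, MulEquiv.orderOf_eq, orderOf_injective _ diagHom_injective]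
    exact IsPrimitiveRoot.orderOf ζ
  · have hact : ∀ g, ρ.orbitMap (ρ.act g₀ y₀) f g =
        ρ.orbitMap (ρ.act (upperElem s) y₀) f (g * g₁) := fun g => by rw [← hy₁, ρ.orbitMap_act]
    rw [hrange]
    constructor
    · intro h g
      have h₁ := hθ c₀ f (g * g₁⁻¹)
      rw [h c₀, hact, hact, hc] at h₁
      simpa only [mul_assoc, inv_mul_cancel, inv_mul_cancel_left, mul_one] using h₁.symm
    · intro h
      -- The right shifts that fix the pullback of `f` form a subgroup, so it suffices that it
      -- contains the generator.
      let H : Subgroup SL(2, K) :=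
        { carrier := {c | ∀ g, ρ.orbitMap (ρ.act g₀ y₀) f (g * c) = ρ.orbitMap (ρ.act g₀ y₀) f g}
          one_mem' := fun g => by rw [mul_one]
          mul_mem' := fun {a b} ha hb g => by rw [← mul_assoc, hb, ha]
          inv_mem' := fun {a} ha g => by rw [← ha, inv_mul_cancel_right] }
      have hcH : (c₀ : SL(2, K)) ∈ H := fun g => by
        rw [hact, hact, hc, ← h (g * g₁)]
        simp only [mul_assoc, inv_mul_cancel, mul_one]
      intro c
      refine ρ.orbitMap_injective hy (funext fun g => ?_)
      rw [hθ]
      obtain ⟨k, rfl⟩ := hc₀ c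
      exact (H.zpow_mem hcH k : (c₀ : SL(2, K)) ^ k ∈ H) g

end Quotient

end ToricSL2

/-! ### Conclusion -/

theorem proposition8 {K : Type*} [Field K] [IsAlgClosed K] [CharZero K]
    {A : Type*} [CommRing A] [IsDomain A] [IsIntegrallyClosed A] [Algebra K A]
    [Algebra.FiniteType K A]
    (p q l : ℕ) (hp : 0 < p) (hpq : p < q) (hcop : Nat.Coprime p q) (hl : 0 < l)
    (ρ : RegularAction (sl2Functions K) A)
    (hX : IsSL2ModCyclicEmbedding ρ (l * (q - p)))
    (hh : HasHeight ρ (l * (q - p)) ((p : ℚ) / q)) :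
    ∃ τ : RegularAction (torusFunctions K 3) A,
      IsToricWithCone τ (PointedCone.hull ℚ
        {![1, 0, 0], ![0, 1, 0], ![-1, 0, (l : ℚ) * q], ![0, -1, (l : ℚ) * p]}) := by
  obtain ⟨B, _, _, _, _, _, ρY, C, -, ⟨y₀, ⟨hy₀, -⟩, himage⟩, hcyc, hcard, hquot⟩ := hh
  have hq : 0 < q := hp.trans hpq
  rw [rowMono_image_heightSet K hq] at himage
  obtain ⟨y, ζ, π, hy, hrow, hζ, hπ, hrange⟩ := exists_orbitMap_quotient
    (Nat.mul_pos hl (Nat.sub_pos_of_lt hpq)) hcard hquot (E := heightSet p q) heightSet_shift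
    (by simp [heightSet]) (by simp [heightSet, hq.ne']) hy₀
    (hasRowMonomials_of_image_eq ρY hy₀ himage)
  have hS := hrow.range_orbitMap (heightSet_pred hpq)
  let ι : A →ₐ[K] (SL(2, K) → K) := (ρY.orbitMap y).comp π
  have hι : Function.Injective ι := (ρY.orbitMap_injective hy).comp hπ
  -- K[X] and the semigroup algebra both embed in the functions on SL(2); having the same image,
  -- they are isomorphic.
  have hιrange : ι.range = (coneHom K (l * q) (l * p)).range := by
    ext F
    rw [mem_range_coneHom_iff hpq hl hζ, ← hS]
    constructor
    · rintro ⟨a, rfl⟩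
      exact ⟨⟨π a, rfl⟩, (hrange (π a)).mp ⟨a, rfl⟩⟩
    · rintro ⟨⟨f, rfl⟩, hF⟩
      obtain ⟨a, rfl⟩ := (hrange f).mpr hF
      exact ⟨a, rfl⟩
  let e : AddMonoidAlgebra K (dualMonoid (sl2Cone ((l * q : ℕ) : ℚ) ((l * p : ℕ) : ℚ))) ≃ₐ[K] A :=
    (AlgEquiv.ofInjective _ (coneHom_injective (Nat.mul_lt_mul_of_pos_left hpq hl))).trans
      ((Subalgebra.equivOfEq _ _ hιrange.symm).trans (AlgEquiv.ofInjective ι hι).symm)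
  have hcone : sl2Cone ((l * q : ℕ) : ℚ) ((l * p : ℕ) : ℚ) = PointedCone.hull ℚ
      {![1, 0, 0], ![0, 1, 0], ![-1, 0, (l : ℚ) * q], ![0, -1, (l : ℚ) * p]} := by
    simp [sl2Cone]
  rw [← hcone]
  exact ⟨torusAction e, isToricWithCone_torusAction (Nat.mul_pos hl hq) (Nat.mul_pos hl hp) e⟩
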